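/- Let $F$ be a field of characteristic different from $2$ and let $S$ be a scheme of finite type over $F$. A flat family of $n$-dimensional quadrics over $S$ is given by a vector bundle $E$ of rank $n+2$ on $S$, a line bundle $L$ on $S$ and an embedding of vector bundles $q\colon L\to S^2E^\vee$ (a morphism that is injective in the fibre at every point of $S$); the family $Q\subset\mathbb{P}_S(E)\to S$ is the zero scheme of $q$. A $k$-section $s$ of the family ($k\ge 0$) is given by a vector subbundle $\mathcal{U}\hookrightarrow E$ of rank $k+1$ that is isotropic for $q$, that is, by the family $\mathbb{P}_S(\mathcal{U})\subset Q$ of $k$-dimensional linear subspaces of the quadrics. It is called nondegenerate if for every geometric point $x$ of $S$ the linear space $\mathbb{P}(\mathcal{U}_x)$ does not meet the singular locus $\mathbb{P}(\ker q_x)$ of the quadric $Q_x$. For a nondegenerate $k$-section $s$, put $\mathcal{U}^\perp=\operatorname{Ker}(E\to\mathcal{U}^\vee\otimes L^\vee)$, where the map is induced by $q$, and $\bar E_s=\mathcal{U}^\perp/\mathcal{U}$, a vector bundle of rank $n-2k$. The form $q$ induces $\bar q_s\colon L\to S^2\bar E_s^\vee$, and the hyperbolic reduction $\bar Q_s\subset\mathbb{P}_S(\bar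 E_s)$ is the zero scheme of $\bar q_s$ (it need not be flat over $S$). Let $K_0(\mathrm{Var}/F)$ be the Grothendieck ring of varieties over $F$: the commutative ring generated by the classes $[X]$ of schemes $X$ of finite type over $F$, with $[X]=[Y]$ if $X\cong Y$ over $F$, with $[X]=[Z]+[X\setminus Z]$ for every closed subscheme $Z\subset X$, with $[X]\cdot[Y]=[X\times_F Y]$ and with $[\operatorname{Spec}F]=1$. **Lemma 2.9.** The class of $\bar Q_s$ does not depend on the choice of the nondegenerate $k$-section $s$: for any two nondegenerate $k$-sections $s$ and $s'$ of the same flat family of $n$-dimensional quadrics over $S$, $$[\bar Q_s]=[\bar Q_{s'}]\quad\text{in } K_0(\mathrm{Var}/F).$$ -/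

import Mathlib

open CategoryTheory AlgebraicGeometry Opposite TopologicalSpace HomogeneousLocalization
open scoped HomogeneousIdeal
universe u

/-- `ρ : M → M'` is the localization of modules at (the powers of) `f`, over the localization
`σ : R → R'` of rings. -/
structure IsLocMap {R R' M M' : Type*} [CommRing R] [CommRing R'] [Zero M] [SMul R M]
    [Zero M'] [SMul R' M'] (σ : R →+* R') (f : R) (ρ : M → M') : Prop where
  isUnit : IsUnit (σ f)
  map_smul : ∀ (r : R) (m : M), ρ (r • m) = σ r • ρ m
  surj : ∀ y : M', ∃ (n : ℕ) (x : M), ρ x = σ (f ^ n) • y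
  ker : ∀ x : M, ρ x = 0 → ∃ n : ℕ, f ^ n • x = 0

theorem qc_aux {S : Scheme.{u}} (M : S.Modules) [M.IsQuasicoherent] {U : S.Opens}
    (hU : IsAffineOpen U) (f : Γ(S, U)) :
    (∀ y : Γ(M, S.basicOpen f), ∃ (n : ℕ) (x : Γ(M, U)),
      M.presheaf.map (homOfLE (S.basicOpen_le f)).op x =
        S.presheaf.map (homOfLE (S.basicOpen_le f)).op (f ^ n) • y) ∧
    (∀ x : Γ(M, U), M.presheaf.map (homOfLE (S.basicOpen_le f)).op x = 0 →
      ∃ n : ℕ, f ^ n • x = 0) := by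
  have hloc : IsLocalizing (modulesSpecToSheaf.obj (M.restrict hU.fromSpec)) := by
    have : (M.restrict hU.fromSpec).IsQuasicoherent := inferInstance
    rw [← isIso_fromTildeΓ_iff_isLocalizing]
    infer_instance
  have h := hloc f
  have e1 : hU.fromSpec ''ᵁ ⊤ = U := by simp
  have e2 : hU.fromSpec ''ᵁ (PrimeSpectrum.basicOpen f) = S.basicOpen f :=
    hU.fromSpec_image_basicOpen f
  have key : ∀ (V : (Spec Γ(S, U)).Opens) (W : S.Opens) (hVW : hU.fromSpec ''ᵁ V = W)
      (hWU : W ≤ U) (r : Γ(S, U)) (x : Γ(M.restrict hU.fromSpec, V)),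
      M.presheaf.map (eqToHom hVW.symm).op ((M.restrictAppIso hU.fromSpec V).hom (r • x)) =
        S.presheaf.map (homOfLE hWU).op r •
          M.presheaf.map (eqToHom hVW.symm).op ((M.restrictAppIso hU.fromSpec V).hom x) := by
    rintro V _ rfl hWU r x
    rw [Scheme.Modules.smul_Spec_def, Scheme.Modules.smul_restrictAppIso_hom_apply]
    have e : (Scheme.ΓSpecIso Γ(S, U)).inv ≫ (Spec Γ(S, U)).presheaf.map V.leTop.op ≫
        (hU.fromSpec.appIso V).inv = S.presheaf.map (homOfLE hWU).op := by
      rw [← cancel_mono (hU.fromSpec.appIso V).hom]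
      simp only [Category.assoc, Iso.inv_hom_id, Category.comp_id]
      rw [Scheme.Hom.appIso_hom, Scheme.Hom.naturality_assoc, hU.fromSpec_app_self]
      simp only [Category.assoc, ← Functor.map_comp]
      rfl
    have e' := congr($(e).hom r)
    simp only [CommRingCat.hom_comp, RingHom.comp_apply] at e'
    simp
    rw [← e']
  have hres : ∀ x : Γ(M.restrict hU.fromSpec, ⊤),
      M.presheaf.map (homOfLE (S.basicOpen_le f)).op
        (M.presheaf.map (eqToHom e1.symm).op ((M.restrictAppIso hU.fromSpec ⊤).hom x)) =
      M.presheaf.map (eqToHom e2.symm).op ((M.restrictAppIso hU.fromSpec _).hom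
        ((M.restrict hU.fromSpec).presheaf.map (PrimeSpectrum.basicOpen f).leTop.op x)) := by
    intro x
    change (M.presheaf.map _ ≫ M.presheaf.map _) _ = (M.presheaf.map _ ≫ M.presheaf.map _) _
    rw [← Functor.map_comp, ← Functor.map_comp]
    rfl
  have hsurj : ∀ (V : (Spec Γ(S, U)).Opens) (W : S.Opens) (hVW : hU.fromSpec ''ᵁ V = W)
      (y : Γ(M, W)), ∃ x : Γ(M.restrict hU.fromSpec, V),
        M.presheaf.map (eqToHom hVW.symm).op ((M.restrictAppIso hU.fromSpec V).hom x) = y := by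
    rintro V _ rfl y
    exact ⟨(M.restrictAppIso hU.fromSpec V).inv y, by simp⟩
  have hinj : ∀ (V : (Spec Γ(S, U)).Opens) (W : S.Opens) (hVW : hU.fromSpec ''ᵁ V = W)
      (x : Γ(M.restrict hU.fromSpec, V)),
        M.presheaf.map (eqToHom hVW.symm).op ((M.restrictAppIso hU.fromSpec V).hom x) = 0 →
        x = 0 := by
    rintro V _ rfl y hy
    have : (M.restrictAppIso hU.fromSpec V).inv ((M.restrictAppIso hU.fromSpec V).hom y) = 0 := by
      have hy' : (M.restrictAppIso hU.fromSpec V).hom y = 0 := by simpa using hy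
      rw [hy', map_zero]
    simpa using this
  have hs : ∀ (V : (Spec Γ(S, U)).Opens) (_ : V = PrimeSpectrum.basicOpen f)
      (y : Γ(M.restrict hU.fromSpec, V)),
      ∃ (n : ℕ) (x : Γ(M.restrict hU.fromSpec, ⊤)), f ^ n • y =
        (M.restrict hU.fromSpec).presheaf.map V.leTop.op x := by
    rintro _ rfl y
    obtain ⟨⟨x, ⟨_, n, rfl⟩⟩, hx⟩ := h.surj y
    exact ⟨n, x, hx⟩
  constructor
  · intro y
    obtain ⟨y, rfl⟩ := hsurj _ _ e2 y
    obtain ⟨n, x, hx⟩ := hs _ rfl y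
    refine ⟨n, M.presheaf.map (eqToHom e1.symm).op ((M.restrictAppIso hU.fromSpec ⊤).hom x), ?_⟩
    rw [hres, ← key _ _ e2 (S.basicOpen_le f)]
    rw [hx]
  · intro x hx
    obtain ⟨x, rfl⟩ := hsurj _ _ e1 x
    rw [hres] at hx
    have hx' := hinj _ _ e2 _ hx
    obtain ⟨⟨_, n, rfl⟩, hn⟩ := h.exists_of_eq (x₁ := x) (x₂ := 0) (by rw [map_zero]; exact hx')
    refine ⟨n, ?_⟩
    have h1 : S.presheaf.map (homOfLE (le_refl U)).op (f ^ n) = f ^ n :=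
      congr($(S.presheaf.map_id (.op U)).hom (f ^ n))
    have hn' : f ^ n • x = 0 := by simpa using! hn
    have := key _ _ e1 le_rfl (f ^ n) x
    rw [h1, hn', map_zero, map_zero] at this
    exact this.symm

namespace IsLocMap

section

variable {R : Type u} [CommRing R] {f : R}

theorem exists_pow_smul {M X : Type*} [AddCommGroup M] [Module R M] [AddCommGroup X] [Module R X] [Module.Finite R M]
    (g : M →ₗ[R] X) (h : ∀ x, ∃ n : ℕ, f ^ n • g x = 0) : ∃ n : ℕ, ∀ x, f ^ n • g x = 0 := by
  obtain ⟨s, hs⟩ := Module.Finite.fg_top (R := R) (M := M)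
  choose n hn using h
  refine ⟨s.sup n, fun x ↦ ?_⟩
  have hx : x ∈ Submodule.span R (s : Set M) := hs ▸ Submodule.mem_top
  induction hx using Submodule.span_induction with
  | mem x hx =>
    obtain ⟨c, hc⟩ := Nat.exists_eq_add_of_le (Finset.le_sup (f := n) hx)
    rw [hc, add_comm, pow_add, mul_smul, hn, smul_zero]
  | zero => rw [map_zero, smul_zero]
  | add x y _ _ hx hy => rw [map_add, smul_add, hx, hy, add_zero]
  | smul r x _ hx => rw [_root_.map_smul, smul_comm, hx, smul_zero]

theorem exists_pow_smul₂ {M N X : Type*} [AddCommGroup M] [Module R M] [AddCommGroup N] [Module R N] [AddCommGroup X] [Module R X]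
    [Module.Finite R M] [Module.Finite R N]
    (g : M →ₗ[R] N →ₗ[R] X) (h : ∀ x y, ∃ n : ℕ, f ^ n • g x y = 0) :
    ∃ n : ℕ, ∀ x y, f ^ n • g x y = 0 := by
  obtain ⟨n, hn⟩ := exists_pow_smul (f := f) g (fun x ↦ by
    obtain ⟨n, hn⟩ := exists_pow_smul (M := N) (X := X) (f := f) (g x) (h x)
    exact ⟨n, LinearMap.ext hn⟩)
  exact ⟨n, fun x y ↦ congr($(hn x) y)⟩

end

section

variable {R R' M M' : Type u} [CommRing R] [CommRing R'] [AddCommGroup M] [Module R M]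
  [AddCommGroup M'] [Module R' M'] {σ : R →+* R'} {f : R}

theorem isLocalization (hσ : IsLocMap σ f σ) :
    letI := σ.toAlgebra
    IsLocalization.Away f R' := by
  letI := σ.toAlgebra
  refine IsLocalization.Away.mk _ hσ.isUnit ?_ ?_
  · intro s
    obtain ⟨n, a, ha⟩ := hσ.surj s
    refine ⟨n, a, ?_⟩
    rw [← map_pow, mul_comm]
    exact ha.symm
  · intro a b hab
    obtain ⟨n, hn⟩ := hσ.ker (a - b) (by
      rw [map_sub]
      exact sub_eq_zero.mpr hab)
    refine ⟨n, ?_⟩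
    rwa [smul_eq_mul, mul_sub, sub_eq_zero] at hn

theorem cancel (hσ : IsUnit (σ f)) {n : ℕ} {y : M'} (h : σ (f ^ n) • y = 0) : y = 0 := by
  obtain ⟨v, hv⟩ := hσ.pow n
  rw [map_pow, ← hv] at h
  exact (smul_eq_zero_iff_eq v).mp h

theorem isLocalizedModule {ρ : M →ₛₗ[σ] M'} (h : IsLocMap σ f ρ) :
    letI := σ.toAlgebra
    letI : Module R M' := Module.compHom M' σ
    IsLocalizedModule (.powers f)
      ({ toFun := ρ, map_add' := map_add ρ, map_smul' := fun r d ↦ ρ.map_smulₛₗ r d } :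
        M →ₗ[R] M') := by
  letI := σ.toAlgebra
  letI : Module R M' := Module.compHom M' σ
  exact
  { map_units := by
      rintro ⟨_, n, rfl⟩
      rw [Module.End.isUnit_iff]
      obtain ⟨v, hv⟩ := h.isUnit.pow n
      have hv' : ∀ d : M', algebraMap R (Module.End R M') (f ^ n) d = v • d := by
        intro d
        rw [Module.algebraMap_end_apply]
        change σ (f ^ n) • d = _
        rw [map_pow, ← hv]
        rfl
      rw [funext hv']
      exact MulAction.bijective v
    surj := fun y ↦ by
      obtain ⟨n, x, hx⟩ := h.surj y
      exact ⟨(x, ⟨_, n, rfl⟩), hx.symm⟩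
    exists_of_eq := fun {x y} hxy ↦ by
      obtain ⟨n, hn⟩ := h.ker (x - y) (by
        rw [map_sub]
        exact sub_eq_zero.mpr hxy)
      refine ⟨⟨_, n, rfl⟩, ?_⟩
      rwa [smul_sub, sub_eq_zero] at hn }

/-- Formation of the dual of a finite module over a Noetherian ring commutes with localization. -/
theorem dual [IsNoetherianRing R] [Module.Finite R M] {ρ : M →ₛₗ[σ] M'} (hσ : IsLocMap σ f σ)
    (h : IsLocMap σ f ρ) : ∃ δ : Module.Dual R M →ₛₗ[σ] Module.Dual R' M',
      (∀ φ m, δ φ (ρ m) = σ (φ m)) ∧ IsLocMap σ f δ := by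
  letI := σ.toAlgebra
  letI : Module R M' := Module.compHom M' σ
  have : IsScalarTower R R' M' := ⟨fun a b c ↦ by rw [Algebra.smul_def, mul_smul]; rfl⟩
  have := hσ.isLocalization
  let ρ' : M →ₗ[R] M' :=
    { toFun := ρ, map_add' := map_add ρ, map_smul' := fun r d ↦ ρ.map_smulₛₗ r d }
  have h1 : IsLocalizedModule (.powers f) ρ' := h.isLocalizedModule
  have := Module.finitePresentation_of_finite R M
  let g : R →ₗ[R] R' := Algebra.linearMap R R'
  let δ := IsLocalizedModule.mapExtendScalars (.powers f) ρ' g R'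
  have h2 : IsLocalizedModule (.powers f) δ :=
    Module.FinitePresentation.isLocalizedModule_mapExtendScalars ..
  have hs : ∀ (r : R) (x : M' →ₗ[R'] R'), r • x = σ r • x := by
    intro r x
    ext m
    change r • x m = σ r • x m
    rw [Algebra.smul_def]
    rfl
  refine ⟨{ toFun := δ, map_add' := map_add δ, map_smul' := fun r φ ↦ ?_ }, fun φ m ↦ ?_, ?_⟩
  · rw [_root_.map_smul, hs]
  · change δ φ (ρ' m) = _
    rw [IsLocalizedModule.mapExtendScalars_apply_apply, IsLocalizedModule.map_apply]
    rfl
  · refine ⟨h.isUnit, fun r φ ↦ ?_, fun y ↦ ?_, fun x hx ↦ ?_⟩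
    · change δ (r • φ) = σ r • δ φ
      rw [_root_.map_smul, hs]
    · obtain ⟨⟨x, ⟨_, n, rfl⟩⟩, hx⟩ := h2.surj y
      refine ⟨n, x, ?_⟩
      change δ x = _
      rw [← hs, ← hx]
      rfl
    · have hx' : δ x = δ 0 := by rw [map_zero]; exact hx
      obtain ⟨⟨_, n, rfl⟩, hn⟩ := h2.exists_of_eq hx'
      exact ⟨n, by simpa using! hn⟩

theorem dual_unique {ρ : M →ₛₗ[σ] M'} (h : IsLocMap σ f ρ)
    {φ ψ : Module.Dual R' M'} (e : ∀ m, φ (ρ m) = ψ (ρ m)) : φ = ψ := by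
  ext y
  obtain ⟨n, x, hx⟩ := h.surj y
  have := e x
  rw [hx, _root_.map_smul, _root_.map_smul, ← sub_eq_zero, ← smul_sub] at this
  exact sub_eq_zero.mp (cancel h.isUnit this)

end

end IsLocMap

namespace ProjLoc

variable {R A R' B : Type u} [CommRing R] [CommRing A] [Algebra R A] [CommRing R'] [CommRing B]
  [Algebra R' B] (𝒜 : ℕ → Submodule R A) [GradedAlgebra 𝒜] (ℬ : ℕ → Submodule R' B)
  [GradedAlgebra ℬ]

/-- The structure map of the projective spectrum of a graded algebra over `R`. -/
noncomputable def projToSpec : Proj 𝒜 ⟶ Spec (CommRingCat.of R) :=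
  Proj.toSpecZero 𝒜 ≫ Spec.map (CommRingCat.ofHom (algebraMap R (𝒜 0)))

theorem val_fromZero (s : A) (x : 𝒜 0) :
    (fromZeroRingHom 𝒜 (.powers s) x).val = Localization.mk (x : A) 1 := rfl

theorem awayι_projToSpec {d : ℕ} (hd : 0 < d) {s : A} (hs : s ∈ 𝒜 d) :
    Proj.awayι 𝒜 s hs hd ≫ projToSpec 𝒜 = Spec.map (CommRingCat.ofHom
      ((fromZeroRingHom 𝒜 (.powers s)).comp (algebraMap R (𝒜 0)))) := by
  rw [projToSpec, Proj.awayι_toSpecZero_assoc, ← Spec.map_comp]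
  rfl

theorem exists_awayι (x : Proj 𝒜) : ∃ (d : ℕ) (hd : 0 < d) (s : A) (hs : s ∈ 𝒜 d) (y : _),
    Proj.awayι 𝒜 s hs hd y = x := by
  obtain ⟨y, hy⟩ := (Proj.affineOpenCover 𝒜).openCover.covers x
  exact ⟨_, _, _, _, y, hy⟩

theorem projToSpec_finiteType [Algebra.FiniteType R A]
    (hs : Function.Surjective (algebraMap R (𝒜 0))) :
    LocallyOfFiniteType (projToSpec 𝒜) ∧ QuasiCompact (projToSpec 𝒜) := by
  have : Algebra.FiniteType (𝒜 0) A := by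
    rw [← RingHom.finiteType_algebraMap]
    refine RingHom.FiniteType.of_comp_finiteType (f := algebraMap R (𝒜 0)) ?_
    have h : (algebraMap (𝒜 0) A).comp (algebraMap R (𝒜 0)) = algebraMap R A := rfl
    rw [h, RingHom.finiteType_algebraMap]
    infer_instance
  have : IsClosedImmersion (Spec.map (CommRingCat.ofHom (algebraMap R (𝒜 0)))) :=
    IsClosedImmersion.spec_of_surjective _ hs
  unfold projToSpec
  constructor <;> infer_instance

variable {𝒜 ℬ} {σ : R →+* R'} {f : R} {ψ : 𝒜 →+*ᵍ ℬ}

theorem map_algebraMap (h : IsLocMap σ f ψ) (r : R) : ψ (algebraMap R A r) = algebraMap R' B (σ r) := by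
  have := h.map_smul r 1
  simpa [Algebra.smul_def] using this

theorem exists_hom (h : IsLocMap σ f ψ) {i : ℕ} {b : B} (hb : b ∈ ℬ i) : ∃ (n : ℕ) (a : A), a ∈ 𝒜 i ∧ ψ a = σ (f ^ n) • b := by
  obtain ⟨n, a, ha⟩ := h.surj b
  refine ⟨n, DirectSum.decompose 𝒜 a i, SetLike.coe_mem _, ?_⟩
  have h1 : ψ a = σ (f ^ n) • b := ha
  rw [map_directSumDecompose 𝒜 ℬ ψ, h1]
  exact DirectSum.decompose_of_mem_same _ (Submodule.smul_mem _ _ hb)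

theorem irrelevant_le (h : IsLocMap σ f ψ) : ℬ₊ ≤ 𝒜₊.map ψ := by
  rw [HomogeneousIdeal.irrelevant_le]
  intro i hi b hb
  obtain ⟨n, a, ha, hab⟩ := exists_hom h hb
  obtain ⟨u, hu⟩ := (h.isUnit.pow n)
  have : b = algebraMap R' B (↑u⁻¹ : R') * ψ a := by
    rw [hab, map_pow, ← hu, ← Algebra.smul_def, smul_smul]
    simp
  rw [this]
  refine Ideal.mul_mem_left _ _ ?_
  exact Ideal.mem_map_of_mem _ (HomogeneousIdeal.mem_irrelevant_of_mem _ hi ha)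

theorem away_map_fromZero (h : IsLocMap σ f ψ) (s : A) (r : R) :
    Away.map ψ s (fromZeroRingHom 𝒜 (.powers s) (algebraMap R (𝒜 0) r)) =
      fromZeroRingHom ℬ (.powers (ψ s)) (algebraMap R' (ℬ 0) (σ r)) := by
  have := map_algebraMap h r
  ext
  change Localization.mk (ψ (algebraMap R A r)) ⟨ψ 1, _⟩ =
    Localization.mk (algebraMap R' B (σ r)) 1
  simp only [this, map_one]
  rfl

theorem away_isLocalization (h : IsLocMap σ f ψ) {d : ℕ} {s : A} (hs : s ∈ 𝒜 d) :
    letI := (Away.map ψ s).toAlgebra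
    IsLocalization.Away (fromZeroRingHom 𝒜 (.powers s) (algebraMap R (𝒜 0) f)) (Away ℬ (ψ s)) := by
  letI := (Away.map ψ s).toAlgebra
  refine IsLocalization.Away.mk _ ?_ ?_ ?_
  · change IsUnit (Away.map ψ s _)
    rw [away_map_fromZero h]
    exact ((h.isUnit.map (algebraMap R' (ℬ 0))).map _)
  · intro b
    obtain ⟨n, b, hb, rfl⟩ := Away.mk_surjective ℬ (ψ.2 hs) b
    obtain ⟨N, a, ha, hab⟩ := exists_hom h hb
    refine ⟨N, Away.mk 𝒜 hs n a ha, ?_⟩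
    change _ * (Away.map ψ s _) ^ N = Away.map ψ s _
    rw [← map_pow, ← map_pow, ← map_pow, away_map_fromZero h, Away.map_mk]
    ext
    rw [val_mul, Away.val_mk, Away.val_mk, val_fromZero, Localization.mk_mul, hab,
      Algebra.smul_def, mul_comm]
    simp
  · intro x y hxy
    obtain ⟨n, a, ha, rfl⟩ := Away.mk_surjective 𝒜 hs x
    obtain ⟨m, b, hb, rfl⟩ := Away.mk_surjective 𝒜 hs y
    replace hxy : Away.map ψ s _ = Away.map ψ s _ := hxy
    rw [Away.map_mk, Away.map_mk] at hxy
    replace hxy := congr_arg HomogeneousLocalization.val hxy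
    rw [Away.val_mk, Away.val_mk, Localization.mk_eq_mk_iff, Localization.r_iff_exists] at hxy
    obtain ⟨⟨_, j, rfl⟩, hj⟩ := hxy
    simp only at hj
    have h0 : ψ (s ^ j * (s ^ m * a) - s ^ j * (s ^ n * b)) = 0 := by
      rw [map_sub, sub_eq_zero]
      simpa using hj
    obtain ⟨N, hN⟩ := h.ker _ h0
    refine ⟨N, ?_⟩
    rw [← map_pow, ← map_pow]
    ext
    rw [val_mul, val_mul, Away.val_mk, Away.val_mk, val_fromZero, Localization.mk_mul,
      Localization.mk_mul, Localization.mk_eq_mk_iff, Localization.r_iff_exists]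
    refine ⟨⟨_, j, rfl⟩, ?_⟩
    simp
    rw [smul_sub, sub_eq_zero, Algebra.smul_def, Algebra.smul_def, map_pow] at hN
    linear_combination hN

theorem isPullback_away (h : IsLocMap σ f ψ) {d : ℕ} (hd : 0 < d) {s : A} (hs : s ∈ 𝒜 d) :
    IsPullback (Spec.map (CommRingCat.ofHom (Away.map ψ s)))
      (Proj.awayι ℬ (ψ s) (ψ.2 hs) hd) (Proj.awayι 𝒜 s hs hd) (Proj.map ψ (irrelevant_le h)) := by
  refine IsOpenImmersion.isPullback _ _ _ _ (Proj.awayι_comp_map ..) ?_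
  rw [Proj.opensRange_awayι, Proj.opensRange_awayι]
  rfl

theorem isOpenImmersion_map (h : IsLocMap σ f ψ) : IsOpenImmersion (Proj.map ψ (irrelevant_le h)) := by
  rw [IsZariskiLocalAtTarget.iff_of_openCover (P := @IsOpenImmersion)
    (Proj.affineOpenCover 𝒜).openCover]
  rintro ⟨d, s⟩
  have hp := (isPullback_away h d.pos s.2)
  letI := (Away.map ψ (s : A)).toAlgebra
  have := away_isLocalization h s.2
  have : IsOpenImmersion (Spec.map (CommRingCat.ofHom (Away.map ψ (s : A)))) :=
    AlgebraicGeometry.IsOpenImmersion.of_isLocalization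
      (fromZeroRingHom 𝒜 (.powers (s : A)) (algebraMap R (𝒜 0) f))
  have e := hp.flip.isoPullback_inv_snd
  have h3 : IsOpenImmersion (Limits.pullback.snd (Proj.map ψ (irrelevant_le h))
      (Proj.awayι 𝒜 (s : A) s.2 (PNat.pos d))) :=
    e ▸ inferInstance
  exact h3

theorem projToSpec_naturality (h : IsLocMap σ f ψ) : Proj.map ψ (irrelevant_le h) ≫ projToSpec 𝒜 =
    projToSpec ℬ ≫ Spec.map (CommRingCat.ofHom σ) := by
  refine ((Proj.affineOpenCoverOfIrrelevantLESpan ℬ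
    (fun x : (Σ d : {d : ℕ // 0 < d}, 𝒜 d) ↦ ψ x.2) (fun x ↦ ψ.2 x.2.2)
    (fun x ↦ x.1.2) ?_).openCover).hom_ext _ _ ?_
  · rw [HomogeneousIdeal.toIdeal_irrelevant_le]
    intro i hi b hb
    obtain ⟨n, a, ha, hab⟩ := exists_hom h hb
    obtain ⟨u, hu⟩ := (h.isUnit.pow n)
    have : b = algebraMap R' B (↑u⁻¹ : R') * ψ a := by
      rw [hab, map_pow, ← hu, ← Algebra.smul_def, smul_smul]
      simp
    rw [this]
    exact Ideal.mul_mem_left _ _ (Ideal.subset_span ⟨⟨⟨i, hi⟩, a, ha⟩, rfl⟩)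
  · rintro ⟨⟨d, hd⟩, s, hs⟩
    change Proj.awayι ℬ (ψ s) (ψ.2 hs) hd ≫ _ = Proj.awayι ℬ (ψ s) (ψ.2 hs) hd ≫ _
    rw [Proj.awayι_comp_map_assoc _ _ hd s hs, awayι_projToSpec, reassoc_of% awayι_projToSpec,
      ← Spec.map_comp, ← Spec.map_comp, ← CommRingCat.ofHom_comp, ← CommRingCat.ofHom_comp]
    congr 2
    ext1 r
    exact away_map_fromZero h s r

theorem isPullback (h : IsLocMap σ f ψ) [Algebra R R'] [IsLocalization.Away f R'] (hσ : σ = algebraMap R R') :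
    IsPullback (projToSpec ℬ) (Proj.map ψ (irrelevant_le h))
    (Spec.map (CommRingCat.ofHom σ)) (projToSpec 𝒜) := by
  subst hσ
  have := isOpenImmersion_map h
  have : IsOpenImmersion (Spec.map (CommRingCat.ofHom (algebraMap R R'))) :=
    AlgebraicGeometry.IsOpenImmersion.of_isLocalization f
  refine IsOpenImmersion.isPullback _ _ _ _ (projToSpec_naturality h) ?_
  ext x
  simp only [Scheme.Hom.coe_preimage, Scheme.Hom.coe_opensRange, Set.mem_preimage]
  obtain ⟨d, hd, s, hs, y, rfl⟩ := exists_awayι _ x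
  have hr : Set.range (Spec.map (CommRingCat.ofHom (algebraMap R R'))) =
    (PrimeSpectrum.basicOpen f : Set (PrimeSpectrum R)) := PrimeSpectrum.localization_away_comap_range R' f
  rw [hr, ← Scheme.Hom.comp_apply, awayι_projToSpec]
  letI := (Away.map ψ s).toAlgebra
  have := away_isLocalization h hs
  have hr' : Set.range (Spec.map (CommRingCat.ofHom (Away.map ψ s))) =
    (PrimeSpectrum.basicOpen (fromZeroRingHom 𝒜 (.powers s) (algebraMap R (𝒜 0) f)) :
      Set (PrimeSpectrum (Away 𝒜 s))) :=
    PrimeSpectrum.localization_away_comap_range (Away ℬ (ψ s)) _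
  trans y ∈ Set.range (Spec.map (CommRingCat.ofHom (Away.map ψ s)))
  · rw [hr']
    rfl
  constructor
  · rintro ⟨z, rfl⟩
    refine ⟨Proj.awayι ℬ (ψ s) (ψ.2 hs) hd z, ?_⟩
    rw [← Scheme.Hom.comp_apply, ← Scheme.Hom.comp_apply, Proj.awayι_comp_map _ _ hd s hs]
  · rintro ⟨z, hz⟩
    have : Proj.map ψ (irrelevant_le h) ⁻¹ᵁ (Proj.awayι 𝒜 s hs hd).opensRange =
        (Proj.awayι ℬ (ψ s) (ψ.2 hs) hd).opensRange := by
      rw [Proj.opensRange_awayι, Proj.opensRange_awayι]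
      rfl
    have hz' : z ∈ (Proj.awayι ℬ (ψ s) (ψ.2 hs) hd).opensRange := by
      rw [← this]
      exact ⟨y, hz.symm⟩
    obtain ⟨w, rfl⟩ := hz'
    refine ⟨w, (Proj.awayι 𝒜 s hs hd).isOpenEmbedding.injective ?_⟩
    rw [← hz, ← Scheme.Hom.comp_apply, ← Scheme.Hom.comp_apply, Proj.awayι_comp_map _ _ hd s hs]

end ProjLoc

namespace ProjLoc

variable {R A R' B R'' C : Type u} [CommRing R] [CommRing A] [Algebra R A] [CommRing R']
  [CommRing B] [Algebra R' B] [CommRing R''] [CommRing C] [Algebra R'' C]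
  {𝒜 : ℕ → Submodule R A} [GradedAlgebra 𝒜] {ℬ : ℕ → Submodule R' B}
  [GradedAlgebra ℬ] {𝒞 : ℕ → Submodule R'' C} [GradedAlgebra 𝒞]
  {σ : R →+* R'} {σ' : R' →+* R''} {σ'' : R →+* R''}

variable (𝒜) in
/-- The projective spectrum of a graded algebra. -/
noncomputable def proj : Scheme.{u} := Proj 𝒜

variable (𝒜) in
/-- The structure map of the projective spectrum of a graded algebra. -/
noncomputable def projStr : proj 𝒜 ⟶ Spec (CommRingCat.of R) := projToSpec 𝒜

/-- The map of projective spectra induced by a localization of graded algebras. -/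
noncomputable def projMap (ψ : 𝒜 →+*ᵍ ℬ) (h : ∃ f, IsLocMap σ f ψ) : proj ℬ ⟶ proj 𝒜 :=
  Proj.map ψ (irrelevant_le h.choose_spec)

theorem projMap_id {σ : R →+* R} (ψ : 𝒜 →+*ᵍ 𝒜) (h : ∃ f, IsLocMap σ f ψ)
    (e : ψ = GradedRingHom.id 𝒜) : projMap ψ h = 𝟙 (proj 𝒜) := by
  subst e
  exact Proj.map_id

theorem projMap_comp (ψ : 𝒜 →+*ᵍ ℬ) (ψ' : ℬ →+*ᵍ 𝒞) (ψ'' : 𝒜 →+*ᵍ 𝒞)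
    (h : ∃ f, IsLocMap σ f ψ) (h' : ∃ f, IsLocMap σ' f ψ') (h'' : ∃ f, IsLocMap σ'' f ψ'')
    (e : ψ'' = ψ'.comp ψ) : projMap ψ'' h'' = projMap ψ' h' ≫ projMap ψ h := by
  subst e
  exact Proj.map_comp ..

end ProjLoc

/-- For a list `t = [(φ₁, ψ₁), …, (φₘ, ψₘ)]` of pairs of linear forms, the quadratic form
`∑ φᵢ ψᵢ`, as an element of the symmetric algebra on the module `D` of linear forms. -/
noncomputable def quadElem {R D : Type u} [CommRing R] [AddCommGroup D] [Module R D]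
    (t : List (D × D)) : SymmetricAlgebra R D :=
  (t.map fun p ↦ SymmetricAlgebra.ι R D p.1 * SymmetricAlgebra.ι R D p.2).sum

/-- The homogeneous coordinate algebra: the symmetric algebra on the module `D` of linear forms,
modulo the ideal generated by the quadratic forms `∑ φᵢ ψᵢ` for `[(φ₁, ψ₁), …]` in `J`. -/
def QuadAlg (R D : Type u) [CommRing R] [AddCommGroup D] [Module R D]
    (J : Set (List (D × D))) : Type u :=
  SymmetricAlgebra R D ⧸ Ideal.span (quadElem (R := R) '' J)

namespace QuadAlg

noncomputable instance {R D : Type u} [CommRing R] [AddCommGroup D] [Module R D]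
    (J : Set (List (D × D))) : CommRing (QuadAlg R D J) :=
  Ideal.Quotient.commRing (Ideal.span (quadElem (R := R) '' J))

noncomputable instance {R D : Type u} [CommRing R] [AddCommGroup D] [Module R D]
    (J : Set (List (D × D))) : Algebra R (QuadAlg R D J) :=
  Ideal.Quotient.algebra R (I := Ideal.span (quadElem (R := R) '' J))

variable {R R' D D' : Type u} [CommRing R] [AddCommGroup D] [Module R D] (J : Set (List (D × D)))
  [CommRing R'] [AddCommGroup D'] [Module R' D'] (J' : Set (List (D' × D')))

variable (R) in
/-- The quotient map. -/
noncomputable def mk : SymmetricAlgebra R D →ₐ[R] QuadAlg R D J :=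
  Ideal.Quotient.mkₐ R (Ideal.span (quadElem (R := R) '' J))

theorem mk_surjective : Function.Surjective (mk R J) := Ideal.Quotient.mk_surjective

theorem mk_eq_zero {x : SymmetricAlgebra R D} (hx : x ∈ Ideal.span (quadElem (R := R) '' J)) :
    mk R J x = 0 := Ideal.Quotient.eq_zero_iff_mem.mpr hx

variable (R) in
/-- The inclusion of the linear forms in the coordinate algebra. -/
noncomputable def gen : D →ₗ[R] QuadAlg R D J :=
  (mk R J).toLinearMap ∘ₗ SymmetricAlgebra.ι R D

theorem gen_apply (d : D) : gen R J d = mk R J (SymmetricAlgebra.ι R D d) := rfl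

theorem mk_quadElem (t : List (D × D)) :
    mk R J (quadElem t) = (t.map fun p ↦ gen R J p.1 * gen R J p.2).sum := by
  simp only [quadElem, map_list_sum, List.map_map]
  congr 1

theorem sum_gen_eq_zero {t : List (D × D)} (ht : t ∈ J) :
    (t.map fun p ↦ gen R J p.1 * gen R J p.2).sum = 0 := by
  rw [← mk_quadElem]
  exact mk_eq_zero J (Ideal.subset_span ⟨t, ht, rfl⟩)

section lift

variable {B : Type u} [CommSemiring B] [Algebra R B] (g : D →ₗ[R] B)
  (hg : ∀ t ∈ J, (t.map fun p ↦ g p.1 * g p.2).sum = 0)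

/-- The universal property of the homogeneous coordinate algebra. -/
noncomputable def lift : QuadAlg R D J →ₐ[R] B :=
  Ideal.Quotient.liftₐ _ (SymmetricAlgebra.lift g) <| by
    change ∀ a ∈ Ideal.span _, a ∈ RingHom.ker (SymmetricAlgebra.lift g)
    rw [← SetLike.le_def, Ideal.span_le]
    rintro _ ⟨t, ht, rfl⟩
    simp only [SetLike.mem_coe, RingHom.mem_ker]
    rw [← hg t ht, quadElem, map_list_sum, List.map_map]
    congr 1
    refine List.map_congr_left fun p _ ↦ ?_
    simp

@[simp] theorem lift_gen (d : D) : lift J g hg (gen R J d) = g d := by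
  rw [gen_apply]
  exact (Ideal.Quotient.lift_mk _ _ _).trans (SymmetricAlgebra.lift_ι_apply g d)

end lift

variable {J} in
theorem ind {P : QuadAlg R D J → Prop} (h1 : ∀ r, P (algebraMap R _ r)) (h2 : ∀ d, P (gen R J d))
    (h3 : ∀ x y, P x → P y → P (x + y)) (h4 : ∀ x y, P x → P y → P (x * y)) (x) : P x := by
  obtain ⟨x, rfl⟩ := mk_surjective J x
  induction x using SymmetricAlgebra.induction with
  | algebraMap r => rw [AlgHom.commutes]; exact h1 r
  | ι d => exact h2 d
  | mul x y hx hy => rw [map_mul]; exact h4 _ _ hx hy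
  | add x y hx hy => rw [map_add]; exact h3 _ _ hx hy

variable {J} in
theorem hom_ext {B : Type*} [CommRing B] {φ ψ : QuadAlg R D J →+* B}
    (h1 : ∀ r, φ (algebraMap R _ r) = ψ (algebraMap R _ r))
    (h2 : ∀ d, φ (gen R J d) = ψ (gen R J d)) : φ = ψ := by
  refine RingHom.ext fun x ↦ ?_
  exact ind (P := fun x ↦ φ x = ψ x) h1 h2 (fun x y hx hy ↦ by rw [map_add, map_add, hx, hy])
    (fun x y hx hy ↦ by rw [map_mul, map_mul, hx, hy]) x

/-- The grading of the coordinate algebra: degree `n` is spanned by the products of `n`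
linear forms. -/
noncomputable abbrev grading (n : ℕ) : Submodule R (QuadAlg R D J) :=
  LinearMap.range (gen R J) ^ n

/-- The linear forms as elements of degree one of the direct sum of the graded pieces. -/
noncomputable def gradedGen : D →ₗ[R] DirectSum ℕ fun i ↦ grading (R := R) J i :=
  DirectSum.lof R ℕ (fun i ↦ grading (R := R) J i) 1 ∘ₗ
    (gen R J).codRestrict _ fun m ↦ by simpa only [pow_one] using LinearMap.mem_range_self (gen R J) m

theorem gradedGen_apply (d : D) :
    gradedGen (R := R) J d = DirectSum.of (fun i ↦ grading (R := R) J i) 1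
      ⟨gen R J d, by simpa only [pow_one] using LinearMap.mem_range_self (gen R J) d⟩ :=
  rfl

theorem gradedGen_rel (t : List (D × D)) (ht : t ∈ J) :
    (t.map fun p ↦ gradedGen (R := R) J p.1 * gradedGen J p.2).sum = 0 := by
  have key : ∀ t : List (D × D),
      ∃ h : (t.map fun p ↦ gen R J p.1 * gen R J p.2).sum ∈ grading (R := R) J 2,
      (t.map fun p ↦ gradedGen (R := R) J p.1 * gradedGen J p.2).sum =
        DirectSum.of (fun i ↦ grading (R := R) J i) 2 ⟨_, h⟩ := by
    intro t
    induction t with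
    | nil =>
      refine ⟨Submodule.zero_mem _, ?_⟩
      simp only [List.map_nil, List.sum_nil]
      exact (map_zero _).symm
    | cons p t ih =>
      obtain ⟨h, e⟩ := ih
      have h' : gen R J p.1 * gen R J p.2 ∈ grading (R := R) J 2 := by
        rw [grading, pow_two]
        exact Submodule.mul_mem_mul ⟨_, rfl⟩ ⟨_, rfl⟩
      refine ⟨by simpa using Submodule.add_mem _ h' h, ?_⟩
      simp only [List.map_cons, List.sum_cons]
      rw [e, gradedGen_apply, gradedGen_apply, DirectSum.of_mul_of]
      have : DirectSum.of (fun i ↦ grading (R := R) J i) 2 ⟨_, Submodule.add_mem _ h' h⟩ =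
        DirectSum.of (fun i ↦ grading (R := R) J i) 2 ⟨_, h'⟩ +
          DirectSum.of (fun i ↦ grading (R := R) J i) 2 ⟨_, h⟩ := by
        rw [← map_add]
        rfl
      exact this.symm
  obtain ⟨h, e⟩ := key t
  rw [e, ← map_zero (DirectSum.of (fun i ↦ grading (R := R) J i) 2)]
  congr 1
  exact Subtype.ext (sum_gen_eq_zero J ht)

/-- The decomposition of the coordinate algebra in graded pieces. -/
noncomputable def gradedLift : QuadAlg R D J →ₐ[R] DirectSum ℕ fun i ↦ grading (R := R) J i :=
  lift J (B := DirectSum ℕ fun i ↦ grading (R := R) J i) (gradedGen J) (gradedGen_rel J)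

theorem gradedLift_gen (d : D) : gradedLift J (gen R J d) = gradedGen J d :=
  lift_gen J (B := DirectSum ℕ fun i ↦ grading (R := R) J i) (gradedGen J) (gradedGen_rel J) d

noncomputable instance : GradedAlgebra (grading (R := R) J) :=
  GradedAlgebra.ofAlgHom _ (gradedLift J)
    (by
      apply AlgHom.coe_ringHom_injective
      refine hom_ext (fun r ↦ ?_) (fun d ↦ ?_)
      · simp
      · simp [gradedLift_gen, gradedGen_apply])
    fun i x ↦ by
    obtain ⟨x, hx⟩ := x
    dsimp only [Subtype.coe_mk, DirectSum.lof_eq_of]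
    induction hx using Submodule.pow_induction_on_left' with
    | algebraMap r =>
      rw [AlgHom.commutes, DirectSum.algebraMap_apply]; rfl
    | add x y i hx hy ihx ihy =>
      rw [map_add, ihx, ihy, ← map_add]
      rfl
    | mem_mul m hm i x hx ih =>
      obtain ⟨_, rfl⟩ := hm
      rw [map_mul, ih, gradedLift_gen, gradedGen_apply, DirectSum.of_mul_of]
      exact DirectSum.of_eq_of_gradedMonoid_eq (Sigma.subtype_ext (add_comm _ _) rfl)

variable {J J'} {σ : R →+* R'} (δ : D →ₛₗ[σ] D') (hδ : ∀ t ∈ J, t.map (Prod.map δ δ) ∈ J')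

/-- The map on coordinate algebras induced by a semilinear map of linear forms. -/
noncomputable def mapAux : QuadAlg R D J →+* QuadAlg R' D' J' :=
  letI := Algebra.compHom (QuadAlg R' D' J') σ
  (lift J (B := QuadAlg R' D' J')
    { toFun d := gen R' J' (δ d)
      map_add' x y := by simp
      map_smul' r d := by
        rw [LinearMap.map_smulₛₗ, LinearMap.map_smul]; rfl }
    (fun t ht ↦ by
      have := sum_gen_eq_zero (R := R') J' (hδ t ht)
      rw [List.map_map] at this
      exact this)).toRingHom

@[simp] theorem mapAux_gen (d : D) : mapAux δ hδ (gen R J d) = gen R' J' (δ d) := by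
  letI := Algebra.compHom (QuadAlg R' D' J') σ
  exact lift_gen J _ _ d

@[simp] theorem mapAux_algebraMap (r : R) :
    mapAux δ hδ (algebraMap R _ r) = algebraMap R' _ (σ r) := by
  letI := Algebra.compHom (QuadAlg R' D' J') σ
  exact AlgHom.commutes _ r

/-- The map on coordinate algebras induced by a semilinear map of linear forms, as a
graded homomorphism. -/
noncomputable def map : grading (R := R) J →+*ᵍ grading (R := R') J' where
  __ := mapAux δ hδ
  map_mem {i x} hx := by
    change mapAux δ hδ x ∈ _
    induction hx using Submodule.pow_induction_on_left' with
    | algebraMap r =>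
      rw [mapAux_algebraMap]
      exact Submodule.algebraMap_mem _
    | add x y i hx hy ihx ihy =>
      rw [map_add]
      exact add_mem ihx ihy
    | mem_mul m hm i x hx ih =>
      obtain ⟨d, rfl⟩ := hm
      rw [map_mul, mapAux_gen, grading, pow_succ']
      exact Submodule.mul_mem_mul ⟨_, rfl⟩ ih

@[simp] theorem map_gen (d : D) : map δ hδ (gen R J d) = gen R' J' (δ d) := mapAux_gen δ hδ d

@[simp] theorem map_algebraMap (r : R) :
    map δ hδ (algebraMap R _ r) = algebraMap R' _ (σ r) := mapAux_algebraMap δ hδ r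

theorem gradedHom_ext {φ ψ : grading (R := R) J →+*ᵍ grading (R := R') J'}
    (h1 : ∀ r, φ (algebraMap R _ r) = ψ (algebraMap R _ r))
    (h2 : ∀ d, φ (gen R J d) = ψ (gen R J d)) : φ = ψ := by
  have : (φ : QuadAlg R D J →+* QuadAlg R' D' J') = ψ := hom_ext h1 h2
  ext x
  exact congr($this x)

theorem isLocMap_map {f : R} (hσ : IsLocMap σ f σ)
    (hD : IsLocMap σ f δ)
    (hJ : ∀ t' ∈ J', ∃ a b : ℕ, ∃ t ∈ J, t.map (Prod.map δ δ) =
      t'.map fun p ↦ (σ (f ^ a) • p.1, σ (f ^ b) • p.2)) :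
    IsLocMap σ f (map δ hδ) where
  isUnit := hσ.isUnit
  map_smul r m := by
    rw [Algebra.smul_def, Algebra.smul_def]
    change map δ hδ _ = _ * map δ hδ _
    simp
  surj y := by
    change ∃ n x, map δ hδ x = _
    induction y using ind with
    | h1 r =>
      obtain ⟨n, x, hx⟩ := hσ.surj r
      refine ⟨n, algebraMap _ _ x, ?_⟩
      rw [map_algebraMap, Algebra.smul_def, ← map_mul]
      exact congr_arg _ hx
    | h2 d =>
      obtain ⟨n, x, hx⟩ := hD.surj d
      refine ⟨n, gen _ _ x, ?_⟩
      rw [map_gen, ← LinearMap.map_smul]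
      exact congr_arg _ hx
    | h3 x y hx hy =>
      obtain ⟨n, x', hx⟩ := hx
      obtain ⟨m, y', hy⟩ := hy
      refine ⟨n + m, f ^ m • x' + f ^ n • y', ?_⟩
      simp only [Algebra.smul_def, map_add, map_mul, map_algebraMap, hx, hy, pow_add] at *
      ring
    | h4 x y hx hy =>
      obtain ⟨n, x', hx⟩ := hx
      obtain ⟨m, y', hy⟩ := hy
      refine ⟨n + m, x' * y', ?_⟩
      simp only [Algebra.smul_def, map_mul, map_algebraMap, hx, hy, pow_add] at *
      ring
  ker x hx := by
    letI := σ.toAlgebra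
    letI : Module R D' := Module.compHom D' σ
    have : IsScalarTower R R' D' := ⟨fun a b c ↦ by
      rw [Algebra.smul_def, mul_smul]; rfl⟩
    have : IsLocalization.Away f R' := by
      refine IsLocalization.Away.mk _ hσ.isUnit ?_ ?_
      · intro s
        obtain ⟨n, a, ha⟩ := hσ.surj s
        refine ⟨n, a, ?_⟩
        rw [← map_pow, mul_comm]
        exact ha.symm
      · intro a b hab
        obtain ⟨n, hn⟩ := hσ.ker (a - b) (by
          change σ (a - b) = 0
          rw [map_sub]
          exact sub_eq_zero.mpr hab)
        refine ⟨n, ?_⟩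
        rwa [smul_eq_mul, mul_sub, sub_eq_zero] at hn
    let δ' : D →ₗ[R] D' :=
      { toFun := δ
        map_add' := map_add δ
        map_smul' := fun r d ↦ LinearMap.map_smulₛₗ δ r d }
    have : IsLocalizedModule (.powers f) δ' :=
      { map_units := by
          rintro ⟨_, n, rfl⟩
          rw [Module.End.isUnit_iff]
          obtain ⟨v, hv⟩ := hσ.isUnit.pow n
          have hv' : ∀ d : D', algebraMap R (Module.End R D') (f ^ n) d = v • d := by
            intro d
            rw [Module.algebraMap_end_apply]
            change σ (f ^ n) • d = _
            rw [map_pow, ← hv]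
            rfl
          rw [funext hv']
          exact MulAction.bijective v
        surj := fun y ↦ by
          obtain ⟨n, x, hx⟩ := hD.surj y
          exact ⟨(x, ⟨_, n, rfl⟩), hx.symm⟩
        exists_of_eq := fun {x y} hxy ↦ by
          obtain ⟨n, hn⟩ := hD.ker (x - y) (by
            change δ (x - y) = 0
            rw [map_sub]
            exact sub_eq_zero.mpr hxy)
          refine ⟨⟨_, n, rfl⟩, ?_⟩
          rwa [smul_sub, sub_eq_zero] at hn }
    let A := QuadAlg R D J
    let Loc := Localization.Away (algebraMap R A f)
    have hu : IsUnit (algebraMap R Loc f) := by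
      rw [IsScalarTower.algebraMap_apply R A Loc]
      exact IsLocalization.Away.algebraMap_isUnit _
    let τ : R' →+* Loc := IsLocalization.Away.lift f hu
    letI : Algebra R' Loc := τ.toAlgebra
    have : IsScalarTower R R' Loc := .of_algebraMap_eq fun r ↦
      (IsLocalization.Away.lift_eq f hu r).symm
    let g₀ : D →ₗ[R] Loc := (IsScalarTower.toAlgHom R A Loc).toLinearMap ∘ₗ gen R J
    have hu' : ∀ x : Submonoid.powers f, IsUnit (algebraMap R (Module.End R Loc) x) := by
      rintro ⟨_, n, rfl⟩
      rw [Module.End.isUnit_iff]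
      obtain ⟨v, hv⟩ := hu.pow n
      have hv' : ∀ d : Loc, algebraMap R (Module.End R Loc) (f ^ n) d = v • d := by
        intro d
        rw [Module.algebraMap_end_apply, Algebra.smul_def, map_pow, ← hv]
        rfl
      rw [funext hv']
      exact MulAction.bijective v
    let g₁ : D' →ₗ[R] Loc := IsLocalizedModule.lift (.powers f) δ' g₀ hu'
    have hg₁ : ∀ d, g₁ (δ d) = g₀ d := fun d ↦ IsLocalizedModule.lift_apply _ _ _ _ d
    let g : D' →ₗ[R'] Loc := LinearMap.extendScalarsOfIsLocalization (.powers f) R' g₁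
    have hsm : ∀ (a : ℕ) (y : D'), g (σ (f ^ a) • y) = algebraMap R Loc f ^ a * g y := by
      intro a y
      rw [LinearMap.map_smul, Algebra.smul_def, ← map_pow]
      congr 1
      exact IsLocalization.Away.lift_eq f hu _
    have hg : ∀ t ∈ J', (t.map fun p ↦ g p.1 * g p.2).sum = 0 := by
      intro t' ht'
      obtain ⟨a, b, t, ht, e⟩ := hJ t' ht'
      have h0 : (t.map fun p ↦ g₀ p.1 * g₀ p.2).sum = 0 := by
        have := congr_arg (algebraMap A Loc) (sum_gen_eq_zero (R := R) J ht)
        rw [map_zero, map_list_sum, List.map_map] at this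
        rw [← this]
        congr 1
        refine List.map_congr_left fun p _ ↦ ?_
        exact (map_mul (algebraMap A Loc) _ _).symm
      have h1 : (t.map fun p ↦ g₀ p.1 * g₀ p.2) =
          (t.map (Prod.map δ δ)).map fun p : D' × D' ↦ g p.1 * g p.2 := by
        rw [List.map_map]
        refine List.map_congr_left fun (p : D × D) _ ↦ ?_
        rw [← hg₁, ← hg₁]
        rfl
      rw [h1, e, List.map_map] at h0
      have h2 : ((fun p : D' × D' ↦ g p.1 * g p.2) ∘ fun p : D' × D' ↦ (σ (f ^ a) • p.1, σ (f ^ b) • p.2)) =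
          fun p : D' × D' ↦ algebraMap R Loc f ^ (a + b) * (g p.1 * g p.2) := by
        funext p
        simp only [Function.comp_apply, hsm]
        ring
      rw [h2, List.sum_map_mul_left] at h0
      exact (hu.pow _).mul_right_eq_zero.mp h0
    have hcomp : (lift J' g hg).toRingHom.comp (map δ hδ : QuadAlg R D J →+* QuadAlg R' D' J') =
        algebraMap A Loc := by
      refine hom_ext (fun r ↦ ?_) (fun d ↦ ?_)
      · change lift J' g hg (map δ hδ _) = _
        rw [map_algebraMap, AlgHom.commutes, ← IsScalarTower.algebraMap_apply R A Loc]
        exact IsLocalization.Away.lift_eq f hu _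
      · change lift J' g hg (map δ hδ _) = _
        rw [map_gen, lift_gen]
        exact hg₁ d
    have hx' : algebraMap A Loc x = 0 := by
      rw [← hcomp]
      change lift J' g hg (map δ hδ x) = 0
      have : map δ hδ x = 0 := hx
      rw [this, map_zero]
    obtain ⟨⟨_, n, rfl⟩, hn⟩ := (IsLocalization.map_eq_zero_iff
      (Submonoid.powers (algebraMap R A f)) Loc x).mp hx'
    refine ⟨n, ?_⟩
    rw [Algebra.smul_def, map_pow]
    exact hn

theorem algebraMap_zero_surjective :
    Function.Surjective (algebraMap R (grading (R := R) J 0)) := by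
  rintro ⟨x, hx⟩
  obtain ⟨r, hr⟩ := Submodule.mem_one.mp (show x ∈ (1 : Submodule R (QuadAlg R D J)) from hx)
  exact ⟨r, Subtype.ext hr⟩

theorem finiteType [Module.Finite R D] : Algebra.FiniteType R (QuadAlg R D J) := by
  obtain ⟨s, hs⟩ := Module.Finite.fg_top (R := R) (M := D)
  classical
  refine ⟨s.image (gen R J), ?_⟩
  rw [eq_top_iff]
  rintro x -
  induction x using ind with
  | h1 r => exact Subalgebra.algebraMap_mem _ r
  | h2 d =>
    have hd : d ∈ Submodule.span R (s : Set D) := hs ▸ Submodule.mem_top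
    induction hd using Submodule.span_induction with
    | mem x hx => exact Algebra.subset_adjoin (by simpa using ⟨x, hx, rfl⟩)
    | zero => rw [map_zero]; exact zero_mem _
    | add x y _ _ hx hy => rw [map_add]; exact add_mem hx hy
    | smul r x _ hx => rw [map_smul]; exact Subalgebra.smul_mem _ hx r
  | h3 x y hx hy => exact add_mem hx hy
  | h4 x y hx hy => exact mul_mem hx hy

variable (R) in
theorem projToSpec_finiteType [Module.Finite R D] :
    LocallyOfFiniteType (ProjLoc.projToSpec (grading (R := R) J)) ∧
      QuasiCompact (ProjLoc.projToSpec (grading (R := R) J)) := by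
  have := finiteType (R := R) (J := J)
  exact ProjLoc.projToSpec_finiteType _ algebraMap_zero_surjective

/-- The projective scheme of the homogeneous coordinate algebra: the scheme of common zeros of the
quadratic forms in `J`, in the projective bundle over `Spec R` with module of linear forms `D`. -/
noncomputable def proj (R : Type u) {D : Type u} [CommRing R] [AddCommGroup D] [Module R D]
    (J : Set (List (D × D))) : Scheme.{u} := ProjLoc.proj (grading (R := R) J)

/-- The structure map of `QuadAlg.proj`. -/
noncomputable def projStr (R : Type u) {D : Type u} [CommRing R] [AddCommGroup D] [Module R D]
    (J : Set (List (D × D))) : proj R J ⟶ Spec (CommRingCat.of R) :=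
  ProjLoc.projStr (grading (R := R) J)

theorem projStr_finiteType [Module.Finite R D] :
    LocallyOfFiniteType (projStr R J) ∧ QuasiCompact (projStr R J) :=
  projToSpec_finiteType R (J := J)

/-- The map on projective schemes induced by a localization map of linear forms. -/
noncomputable def projMap (h : ∃ f, IsLocMap σ f (map δ hδ)) :
    proj R' J' ⟶ proj R J :=
  ProjLoc.projMap (map δ hδ) h

theorem projMap_projStr (h : ∃ f, IsLocMap σ f (map δ hδ)) :
    projMap δ hδ h ≫ projStr R J =
      projStr R' J' ≫ Spec.map (CommRingCat.ofHom σ) :=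
  ProjLoc.projToSpec_naturality h.choose_spec

theorem isPullback_projMap (h : ∃ f, IsLocMap σ f (map δ hδ) ∧ IsLocMap σ f σ) :
    IsPullback (projMap δ hδ (h.imp fun _ ↦ And.left)) (projStr R' J')
      (projStr R J) (Spec.map (CommRingCat.ofHom σ)) := by
  obtain ⟨f, h1, h2⟩ := id h
  letI := σ.toAlgebra
  have : IsLocalization.Away f R' := h2.isLocalization
  exact (ProjLoc.isPullback h1 rfl).flip

theorem projMap_id {J : Set (List (D × D))} {σ : R →+* R} (δ : D →ₛₗ[σ] D)
    (hδ : ∀ t ∈ J, t.map (Prod.map δ δ) ∈ J) (h : ∃ f, IsLocMap σ f (map δ hδ))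
    (h1 : ∀ r, σ r = r) (h2 : ∀ d, δ d = d) : projMap δ hδ h = 𝟙 (proj R J) := by
  have e : map δ hδ = GradedRingHom.id (grading (R := R) J) := by
    refine gradedHom_ext (fun r ↦ ?_) (fun d ↦ ?_)
    · rw [map_algebraMap, h1]
      rfl
    · rw [map_gen, h2]
      rfl
  exact ProjLoc.projMap_id _ h e

theorem projMap_comp {R'' D'' : Type u} [CommRing R''] [AddCommGroup D''] [Module R'' D'']
    {J'' : Set (List (D'' × D''))} {σ' : R' →+* R''} {σ'' : R →+* R''}
    (δ' : D' →ₛₗ[σ'] D'') (hδ' : ∀ t ∈ J', t.map (Prod.map δ' δ') ∈ J'')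
    (δ'' : D →ₛₗ[σ''] D'') (hδ'' : ∀ t ∈ J, t.map (Prod.map δ'' δ'') ∈ J'')
    (h : ∃ f, IsLocMap σ f (map δ hδ)) (h' : ∃ f, IsLocMap σ' f (map δ' hδ'))
    (h'' : ∃ f, IsLocMap σ'' f (map δ'' hδ''))
    (h1 : ∀ r, σ'' r = σ' (σ r)) (h2 : ∀ d, δ'' d = δ' (δ d)) :
    projMap δ'' hδ'' h'' = projMap δ' hδ' h' ≫ projMap δ hδ h := by
  have e : map δ'' hδ'' = (map δ' hδ').comp (map δ hδ) := by
    refine gradedHom_ext (fun r ↦ ?_) (fun d ↦ ?_)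
    · change _ = map δ' hδ' (map δ hδ _)
      rw [map_algebraMap, map_algebraMap, map_algebraMap, h1]
    · change _ = map δ' hδ' (map δ hδ _)
      rw [map_gen, map_gen, map_gen, h2]
  exact ProjLoc.projMap_comp _ _ _ h h' h'' e

end QuadAlg

namespace HypRed

section

variable {R E L W : Type u} [CommRing R] [AddCommGroup E] [Module R E] [AddCommGroup L] [Module R L]
  [AddCommGroup W] [Module R W] (q : L →ₗ[R] E →ₗ[R] E →ₗ[R] R) (ι : W →ₗ[R] E)

/-- The orthogonal complement `W^⊥` in `E` of the submodule `ι : W → E`, with respect to all the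
bilinear forms `q l`. -/
def perp : Submodule R E where
  carrier := {e | ∀ l w, q l (ι w) e = 0}
  add_mem' ha hb l w := by rw [map_add, ha, hb, add_zero]
  zero_mem' l w := map_zero _
  smul_mem' r a ha l w := by rw [map_smul, ha, smul_zero]

/-- The module `W^⊥ / W`. -/
abbrev Red : Type u := perp q ι ⧸ (LinearMap.range ι).submoduleOf (perp q ι)

/-- The lists `[(φ₁, ψ₁), …, (φₘ, ψₘ)]` of pairs of linear forms on `W^⊥ / W` such that
`∑ φᵢ(x) ψᵢ(y)` is the bilinear form on `W^⊥ / W` induced by `q l` for some `l`. -/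
def forms : Set (List (Module.Dual R (Red q ι) × Module.Dual R (Red q ι))) :=
  {t | ∃ l, ∀ x y : perp q ι, (t.map fun p ↦
    p.1 (Submodule.Quotient.mk x) * p.2 (Submodule.Quotient.mk y)).sum = q l x y}

end

variable {R E L W : Type u} [CommRing R] [AddCommGroup E] [Module R E] [AddCommGroup L] [Module R L]
  [AddCommGroup W] [Module R W] {q : L →ₗ[R] E →ₗ[R] E →ₗ[R] R} {ι : W →ₗ[R] E}
  {R' E' L' W' : Type u} [CommRing R'] [AddCommGroup E'] [Module R' E'] [AddCommGroup L']
  [Module R' L'] [AddCommGroup W'] [Module R' W'] {q' : L' →ₗ[R'] E' →ₗ[R'] E' →ₗ[R'] R'}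
  {ι' : W' →ₗ[R'] E'} {σ : R →+* R'} {ρE : E →ₛₗ[σ] E'} {ρL : L →ₛₗ[σ] L'} {ρW : W →ₛₗ[σ] W'}

variable (q ι q' ι' ρE ρL ρW) in
/-- The localization at `f` of a quadratic form with values in `L` and of a submodule. -/
structure Loc (f : R) : Prop where
  hR : IsLocMap σ f σ
  hE : IsLocMap σ f ρE
  hL : IsLocMap σ f ρL
  hW : IsLocMap σ f ρW
  q_map : ∀ l e e', q' (ρL l) (ρE e) (ρE e') = σ (q l e e')
  ι_map : ∀ w, ι' (ρW w) = ρE (ι w)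

namespace Loc

variable {f : R}

theorem mem_perp (H : Loc q ι q' ι' ρE ρL ρW f) (x : E) (hx : x ∈ perp q ι) : ρE x ∈ perp q' ι' := by
  intro l' w'
  obtain ⟨a, l, hl⟩ := H.hL.surj l'
  obtain ⟨b, w, hw⟩ := H.hW.surj w'
  have : σ (f ^ a) • σ (f ^ b) • q' l' (ι' w') (ρE x) = 0 := by
    have h1 := H.q_map l (ι w) x
    rw [hx, map_zero, ← H.ι_map, hl, hw] at h1
    rw [smul_comm]
    simpa only [map_smul, LinearMap.smul_apply] using h1
  exact IsLocMap.cancel H.hR.isUnit (IsLocMap.cancel H.hR.isUnit this)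

variable (q ι q' ι' ρE) in
/-- The restriction map on `W^⊥ / W`. -/
def redMap (h1 : ∀ x ∈ perp q ι, ρE x ∈ perp q' ι')
    (h2 : LinearMap.range ι ≤ (LinearMap.range ι').comap ρE) : Red q ι →ₛₗ[σ] Red q' ι' :=
  Submodule.mapQ _ _ (ρE.restrict h1) fun _ hx ↦ h2 hx

theorem isLocMap_perp (H : Loc q ι q' ι' ρE ρL ρW f) [Module.Finite R L] [Module.Finite R W] :
    IsLocMap σ f (ρE.restrict H.mem_perp) where
  isUnit := H.hR.isUnit
  map_smul r m := LinearMap.map_smulₛₗ _ r m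
  surj := by
    rintro ⟨y, hy⟩
    obtain ⟨n, x, hx⟩ := H.hE.surj y
    obtain ⟨m, hm⟩ := IsLocMap.exists_pow_smul₂ (f := f)
      (LinearMap.mk₂ R (fun l w ↦ q l (ι w) x) (by simp) (by simp) (by simp) (by simp)) (fun l w ↦ by
        refine H.hR.ker _ ?_
        change σ (q l (ι w) x) = 0
        rw [← H.q_map, hx, ← H.ι_map, map_smul, hy, smul_zero])
    refine ⟨m + n, ⟨f ^ m • x, fun l w ↦ ?_⟩, ?_⟩
    · rw [map_smul]
      exact hm l w
    · refine Subtype.ext ?_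
      change ρE (f ^ m • x) = σ (f ^ (m + n)) • y
      rw [LinearMap.map_smulₛₗ, hx, pow_add, map_mul, mul_smul]
  ker x hx := by
    obtain ⟨n, hn⟩ := H.hE.ker x (congr_arg Subtype.val hx)
    exact ⟨n, Subtype.ext hn⟩

theorem range_le (H : Loc q ι q' ι' ρE ρL ρW f) : LinearMap.range ι ≤ (LinearMap.range ι').comap ρE := by
  rintro _ ⟨w, rfl⟩
  exact ⟨ρW w, H.ι_map w⟩

theorem isLocMap_redMap (H : Loc q ι q' ι' ρE ρL ρW f) [Module.Finite R L] [Module.Finite R W] :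
    IsLocMap σ f (redMap q ι q' ι' ρE H.mem_perp H.range_le) where
  isUnit := H.hR.isUnit
  map_smul r m := LinearMap.map_smulₛₗ _ r m
  surj y := by
    obtain ⟨y, rfl⟩ := Submodule.Quotient.mk_surjective _ y
    obtain ⟨n, x, hx⟩ := H.isLocMap_perp.surj y
    exact ⟨n, Submodule.Quotient.mk x, congr_arg Submodule.Quotient.mk hx⟩
  ker x hx := by
    obtain ⟨⟨x, hx'⟩, rfl⟩ := Submodule.Quotient.mk_surjective _ x
    have h1 : ρE x ∈ LinearMap.range ι' :=
      (Submodule.Quotient.mk_eq_zero ((LinearMap.range ι').submoduleOf (perp q' ι'))).mp hx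
    obtain ⟨w', hw'⟩ := h1
    obtain ⟨n, w, hw⟩ := H.hW.surj w'
    obtain ⟨m, hm⟩ := H.hE.ker (f ^ n • x - ι w) (by
      rw [map_sub, ← H.ι_map, hw, LinearMap.map_smulₛₗ, map_smul, hw', sub_self])
    refine ⟨m + n, (Submodule.Quotient.mk_eq_zero
      ((LinearMap.range ι).submoduleOf (perp q ι))).mpr ⟨f ^ m • w, ?_⟩⟩
    rw [smul_sub, sub_eq_zero] at hm
    rw [map_smul, ← hm]
    change _ = f ^ (m + n) • x
    rw [pow_add, mul_smul]

variable {δ : Module.Dual R (Red q ι) →ₛₗ[σ] Module.Dual R' (Red q' ι')}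

theorem map_sum (H : Loc q ι q' ι' ρE ρL ρW f)
    (hδ : ∀ φ m, δ φ (redMap q ι q' ι' ρE H.mem_perp H.range_le m) = σ (φ m)) (t : List (Module.Dual R (Red q ι) × Module.Dual R (Red q ι))) (x y : perp q ι)
    (x' y' : perp q' ι') (hx : ρE x = x') (hy : ρE y = y') :
    ((t.map (Prod.map δ δ)).map fun p ↦
      p.1 (Submodule.Quotient.mk x') * p.2 (Submodule.Quotient.mk y')).sum =
    σ (t.map fun p ↦
      p.1 (Submodule.Quotient.mk x) * p.2 (Submodule.Quotient.mk y)).sum := by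
  have hx' : (Submodule.Quotient.mk x' : Red q' ι') =
      redMap q ι q' ι' ρE H.mem_perp H.range_le (Submodule.Quotient.mk x) :=
    congr_arg Submodule.Quotient.mk (Subtype.ext hx.symm)
  have hy' : (Submodule.Quotient.mk y' : Red q' ι') =
      redMap q ι q' ι' ρE H.mem_perp H.range_le (Submodule.Quotient.mk y) :=
    congr_arg Submodule.Quotient.mk (Subtype.ext hy.symm)
  rw [map_list_sum, List.map_map, List.map_map]
  congr 1
  refine List.map_congr_left fun p _ ↦ ?_
  simp only [Function.comp_apply, Prod.map_fst, Prod.map_snd, map_mul, hx', hy', hδ]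

theorem forms_map (H : Loc q ι q' ι' ρE ρL ρW f)
    (hδ : ∀ φ m, δ φ (redMap q ι q' ι' ρE H.mem_perp H.range_le m) = σ (φ m)) [Module.Finite R L] [Module.Finite R W] (t) (ht : t ∈ forms q ι) : t.map (Prod.map δ δ) ∈ forms q' ι' := by
  obtain ⟨l, hl⟩ := ht
  refine ⟨ρL l, fun x' y' ↦ ?_⟩
  obtain ⟨a, x, hx⟩ := (H.isLocMap_perp).surj x'
  obtain ⟨b, y, hy⟩ := (H.isLocMap_perp).surj y'
  have h1 := H.map_sum hδ t x y _ _ (congr_arg Subtype.val hx) (congr_arg Subtype.val hy)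
  rw [hl, ← H.q_map] at h1
  have hx' : ρE x = σ (f ^ a) • (x' : E') := congr_arg Subtype.val hx
  have hy' : ρE y = σ (f ^ b) • (y' : E') := congr_arg Subtype.val hy
  rw [hx', hy', map_smul, map_smul, LinearMap.smul_apply] at h1
  have h2 : σ (f ^ a) • σ (f ^ b) • (((t.map (Prod.map δ δ)).map fun p ↦
      p.1 (Submodule.Quotient.mk x') * p.2 (Submodule.Quotient.mk y')).sum -
      q' (ρL l) x' y') = 0 := by
    rw [smul_sub, smul_sub, sub_eq_zero, smul_comm _ _ (q' (ρL l) x' y'), ← h1, smul_eq_mul,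
      smul_eq_mul, ← List.sum_map_mul_left, ← List.sum_map_mul_left]
    congr 1
    refine List.map_congr_left fun p _ ↦ ?_
    rw [Submodule.Quotient.mk_smul, Submodule.Quotient.mk_smul, map_smul, map_smul, smul_eq_mul,
      smul_eq_mul]
    ring
  exact sub_eq_zero.mp (IsLocMap.cancel H.hR.isUnit (IsLocMap.cancel H.hR.isUnit h2))

theorem forms_surj (H : Loc q ι q' ι' ρE ρL ρW f)
    (hδ : ∀ φ m, δ φ (redMap q ι q' ι' ρE H.mem_perp H.range_le m) = σ (φ m)) [IsNoetherianRing R] [Module.Finite R E] (hD : IsLocMap σ f δ)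
    (t') (ht' : t' ∈ forms q' ι') : ∃ a b : ℕ, ∃ t ∈ forms q ι,
    t.map (Prod.map δ δ) = t'.map fun p ↦ (σ (f ^ a) • p.1, σ (f ^ b) • p.2) := by
  obtain ⟨l', hl'⟩ := ht'
  obtain ⟨c, l, hl⟩ := H.hL.surj l'
  have lift : ∀ t' : List (Module.Dual R' (Red q' ι') × Module.Dual R' (Red q' ι')),
      ∃ (n : ℕ) (t : List (Module.Dual R (Red q ι) × Module.Dual R (Red q ι))),
      t.map (Prod.map δ δ) = t'.map fun p ↦ (σ (f ^ n) • p.1, σ (f ^ n) • p.2) := by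
    intro t'
    induction t' with
    | nil => exact ⟨0, [], rfl⟩
    | cons p t' ih =>
      obtain ⟨n, t, ht⟩ := ih
      obtain ⟨a, φ, hφ⟩ := hD.surj p.1
      obtain ⟨b, ψ, hψ⟩ := hD.surj p.2
      refine ⟨n + a + b, (f ^ (n + b) • φ, f ^ (n + a) • ψ) ::
        t.map (fun p ↦ (f ^ (a + b) • p.1, f ^ (a + b) • p.2)), ?_⟩
      simp only [List.map_cons]
      congr 1
      · refine Prod.ext ?_ ?_
        · change δ (_ • φ) = _
          rw [LinearMap.map_smulₛₗ, hφ, smul_smul, ← map_mul, ← pow_add]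
          congr 3
          omega
        · change δ (_ • ψ) = _
          rw [LinearMap.map_smulₛₗ, hψ, smul_smul, ← map_mul, ← pow_add]
      · rw [List.map_map]
        have : t.map (Prod.map δ δ ∘ fun p ↦ (f ^ (a + b) • p.1, f ^ (a + b) • p.2)) =
            (t.map (Prod.map δ δ)).map
              (fun p ↦ (σ (f ^ (a + b)) • p.1, σ (f ^ (a + b)) • p.2)) := by
          rw [List.map_map]
          refine List.map_congr_left fun p _ ↦ ?_
          simp [Prod.map]
        rw [this, ht, List.map_map]
        refine List.map_congr_left fun p _ ↦ ?_
        simp only [Function.comp_apply, smul_smul, ← map_mul, ← pow_add]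
        rw [show a + b + n = n + a + b by omega]
  obtain ⟨n, t, ht⟩ := lift t'
  have hsum : ∀ (t : List (Module.Dual R (Red q ι) × Module.Dual R (Red q ι))) x y,
      (t.map fun p ↦ LinearMap.compl₁₂ (LinearMap.mul R R) p.1 p.2).sum x y =
        (t.map fun p ↦ p.1 x * p.2 y).sum := by
    intro t x y
    induction t with
    | nil => simp
    | cons p t ih =>
      simp only [List.map_cons, List.sum_cons, LinearMap.add_apply, ih]
      rfl
  let B : perp q ι →ₗ[R] perp q ι →ₗ[R] R :=
    f ^ c • LinearMap.compl₁₂ (t.map fun p ↦ LinearMap.compl₁₂ (LinearMap.mul R R) p.1 p.2).sum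
      (Submodule.mkQ _) (Submodule.mkQ _) -
    f ^ (n + n) • (q l).domRestrict₁₂ (perp q ι) (perp q ι)
  have hB : ∀ x y, B x y = f ^ c * (t.map fun p ↦
      p.1 (Submodule.Quotient.mk x) * p.2 (Submodule.Quotient.mk y)).sum -
      f ^ (n + n) * q l x y := by
    intro x y
    rw [← hsum]
    rfl
  obtain ⟨m, hm⟩ := IsLocMap.exists_pow_smul₂ (f := f) B (fun x y ↦ by
    refine H.hR.ker _ ?_
    have h1 := H.map_sum hδ t x y ⟨_, H.mem_perp x x.2⟩ ⟨_, H.mem_perp y y.2⟩ rfl rfl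
    rw [ht, List.map_map] at h1
    have h2 := hl' ⟨_, H.mem_perp x x.2⟩ ⟨_, H.mem_perp y y.2⟩
    rw [hB, map_sub, map_mul, map_mul, ← h1, ← H.q_map, hl, sub_eq_zero, map_smul,
      LinearMap.smul_apply, LinearMap.smul_apply, ← h2, smul_eq_mul, mul_left_comm]
    congr 1
    rw [← List.sum_map_mul_left]
    congr 1
    refine List.map_congr_left fun p _ ↦ ?_
    simp only [Function.comp_apply, LinearMap.smul_apply, smul_eq_mul, pow_add, map_mul]
    ring)
  refine ⟨m + c + n, n, t.map fun p ↦ (f ^ (m + c) • p.1, p.2),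
    ⟨f ^ (m + (n + n)) • l, fun x y ↦ ?_⟩, ?_⟩
  · have h1 := hm x y
    rw [hB, smul_sub, sub_eq_zero, smul_eq_mul, smul_eq_mul, ← mul_assoc, ← mul_assoc,
      ← pow_add, ← pow_add] at h1
    rw [map_smul, LinearMap.smul_apply, LinearMap.smul_apply, smul_eq_mul, ← h1, List.map_map,
      ← List.sum_map_mul_left]
    congr 1
    refine List.map_congr_left fun p _ ↦ ?_
    simp only [Function.comp_apply, LinearMap.smul_apply, smul_eq_mul]
    ring
  · have h1 : (t.map fun p ↦ (f ^ (m + c) • p.1, p.2)).map (Prod.map δ δ) =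
        (t.map (Prod.map δ δ)).map fun p ↦ (σ (f ^ (m + c)) • p.1, p.2) := by
      rw [List.map_map, List.map_map]
      refine List.map_congr_left fun p _ ↦ ?_
      simp [Prod.map]
    rw [h1, ht, List.map_map]
    refine List.map_congr_left fun p _ ↦ ?_
    simp only [Function.comp_apply, smul_smul, ← map_mul, ← pow_add]

end Loc

end HypRed

theorem local_locallyOfFiniteType : ∃ P : MorphismProperty Scheme.{u},
    IsZariskiLocalAtTarget P ∧ ∀ {X Y : Scheme.{u}} (f : X ⟶ Y), P f ↔ LocallyOfFiniteType f := by
  refine ⟨@LocallyOfFiniteType, ?_, fun _ ↦ Iff.rfl⟩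
  have : HasRingHomProperty (@LocallyOfFiniteType.{u}) RingHom.FiniteType := inferInstance
  exact @HasRingHomProperty.instIsZariskiLocalAtTarget _ _ this

theorem local_quasiCompact : ∃ P : MorphismProperty Scheme.{u},
    IsZariskiLocalAtTarget P ∧ ∀ {X Y : Scheme.{u}} (f : X ⟶ Y), P f ↔ QuasiCompact f :=
  ⟨@QuasiCompact, @HasAffineProperty.instIsZariskiLocalAtTarget _ _
    AlgebraicGeometry.instHasAffinePropertyQuasiCompactCompactSpaceCarrierCarrierCommRingCat,
    fun _ ↦ Iff.rfl⟩

theorem locallyOfFiniteType_comp_isIso {X Y Z : Scheme.{u}} (f : X ⟶ Y) (g : Y ⟶ Z)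
    (_ : LocallyOfFiniteType f) (_ : IsIso g) : LocallyOfFiniteType (f ≫ g) :=
  inferInstance

theorem quasiCompact_comp_isIso {X Y Z : Scheme.{u}} (f : X ⟶ Y) (g : Y ⟶ Z)
    (_ : QuasiCompact f) (_ : IsIso g) : QuasiCompact (f ≫ g) :=
  inferInstance

section Bundles

variable {S : Scheme.{u}}

theorem site_le {U V : S.AffineZariskiSite} (h : V ≤ U) : V.toOpens ≤ U.toOpens :=
  Scheme.AffineZariskiSite.toOpens_mono h

/-- The map on sections over `U` of a morphism of sheaves of modules, as a linear map. -/
noncomputable def appLin {M N : S.Modules} (φ : M ⟶ N) (U : S.Opens) : Γ(M, U) →ₗ[Γ(S, U)] Γ(N, U) where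
  toFun x := φ.app U x
  map_add' x y := map_add _ x y
  map_smul' r x := Scheme.Modules.Hom.app_smul φ r x

/-- The restriction of functions. -/
abbrev resFun {U V : S.Opens} (h : V ≤ U) : Γ(S, U) →+* Γ(S, V) :=
  (S.presheaf.map (homOfLE h).op).hom

/-- The restriction of sections of a sheaf of modules. -/
noncomputable def res (M : S.Modules) {U V : S.Opens} (h : V ≤ U) : Γ(M, U) →ₛₗ[resFun h] Γ(M, V) where
  toFun x := M.presheaf.map (homOfLE h).op x
  map_add' x y := map_add _ x y
  map_smul' r x := Scheme.Modules.map_smul M (homOfLE h) r x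

theorem appLin_res {M N : S.Modules} (φ : M ⟶ N) {U V : S.Opens} (h : V ≤ U) (x : Γ(M, U)) :
    appLin φ V (res M h x) = res N h (appLin φ U x) :=
  congr($(φ.mapPresheaf.naturality (homOfLE h).op) x)

/-- A vector bundle of rank `r`: a quasi-coherent sheaf which on every affine open is given by a
finitely generated projective module of constant rank `r`. -/
structure IsVectorBundle (M : S.Modules) (r : ℕ) : Prop where
  isQuasicoherent : M.IsQuasicoherent
  finite : ∀ U : S.Opens, IsAffineOpen U → Module.Finite Γ(S, U) Γ(M, U)
  projective : ∀ U : S.Opens, IsAffineOpen U → Module.Projective Γ(S, U) Γ(M, U)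
  rank : ∀ U : S.Opens, IsAffineOpen U → ∀ x : PrimeSpectrum Γ(S, U),
    Module.rankAtStalk Γ(M, U) x = r

/-- A flat family of quadrics of dimension `n` over `S`: a vector bundle `E` of rank `n + 2`,
a line bundle `L` and an embedding of vector bundles of `L` in the bundle of symmetric bilinear
forms on `E`, given by compatible maps on sections. -/
structure QuadricFamily (S : Scheme.{u}) (n : ℕ) where
  E : S.Modules
  L : S.Modules
  isVectorBundle_E : IsVectorBundle E (n + 2)
  isVectorBundle_L : IsVectorBundle L 1
  q : ∀ U : S.Opens,
    Γ(L, U) →ₗ[Γ(S, U)] Γ(E, U) →ₗ[Γ(S, U)] Γ(E, U) →ₗ[Γ(S, U)] Γ(S, U)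
  q_res : ∀ {U V : S.Opens} (h : V ≤ U) (l : Γ(L, U)) (e e' : Γ(E, U)),
    q V (res L h l) (res E h e) (res E h e') = resFun h (q U l e e')
  symm : ∀ (U : S.Opens) (l : Γ(L, U)) (e e' : Γ(E, U)), q U l e e' = q U l e' e
  /-- The map from `L` to the bundle of symmetric bilinear forms on `E` is non-zero, hence
  injective, in the fibre at every point. -/
  embedding : ∀ x : S, ∃ U : S.Opens, x ∈ U ∧
    ∃ (l : Γ(L, U)) (e e' : Γ(E, U)), x ∈ S.basicOpen (q U l e e')

/-- A `k`-section of a family of quadrics: a vector subbundle `W` of `E` of rank `k + 1`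
which is isotropic, that is, a family over `S` of `k`-dimensional linear subspaces of the
quadrics. -/
structure LinearSection {n : ℕ} (Q : QuadricFamily S n) (k : ℕ) where
  W : S.Modules
  isVectorBundle : IsVectorBundle W (k + 1)
  ι : W ⟶ Q.E
  injective : ∀ U : S.Opens, IsAffineOpen U → Function.Injective (appLin ι U)
  projective : ∀ U : S.Opens, IsAffineOpen U →
    Module.Projective Γ(S, U) (Γ(Q.E, U) ⧸ LinearMap.range (appLin ι U))
  isotropic : ∀ (U : S.Opens) (l : Γ(Q.L, U)) (w w' : Γ(W, U)),
    Q.q U l (appLin ι U w) (appLin ι U w') = 0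

namespace LinearSection

variable {n k : ℕ} {Q : QuadricFamily S n} (s : LinearSection Q k)

open scoped TensorProduct in
/-- A section is nondegenerate if in the fibre over any geometric point the linear subspace does
not meet the singular locus of the quadric, that is (as `2` is invertible, by the Jacobian
criterion), contains no point of the projectivization of the kernel of the quadratic form.
A geometric point of `S` is given by a ring map from the functions on an affine open `U` to an
algebraically closed field `Ω`, and the fibres of the bundles are obtained by base change. -/
def Nondegenerate : Prop :=
  ∀ U : S.Opens, IsAffineOpen U →
    ∀ (Ω : Type u) [Field Ω] [IsAlgClosed Ω] [Algebra Γ(S, U) Ω] (v : Ω ⊗[Γ(S, U)] Γ(s.W, U)),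
      v ≠ 0 → ∃ (l : Γ(Q.L, U)) (e : Γ(Q.E, U)),
        (Algebra.linearMap Γ(S, U) Ω ∘ₗ Q.q U l e).liftBaseChange Ω
          ((appLin s.ι U).baseChange Ω v) ≠ 0

variable (U : S.AffineZariskiSite)

/-- Sections over `U` of the bundle `W^⊥ / W`. -/
abbrev Ebar : Type u := HypRed.Red (Q.q U.toOpens) (appLin s.ι U.toOpens)

/-- The linear forms on `W^⊥ / W` over `U`. -/
abbrev Dual : Type u := Module.Dual Γ(S, U.toOpens) (s.Ebar U)

/-- The expressions of the bilinear forms on `W^⊥ / W` over `U` induced from those of the family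
as sums of products of two linear forms. -/
abbrev forms : Set (List (s.Dual U × s.Dual U)) :=
  HypRed.forms (Q.q U.toOpens) (appLin s.ι U.toOpens)

end LinearSection

theorem isLocMap_res (M : S.Modules) {r : ℕ} (hM : IsVectorBundle M r) {U : S.Opens}
    (hU : IsAffineOpen U) (f : Γ(S, U)) :
    IsLocMap (resFun (S.basicOpen_le f)) f (res M (S.basicOpen_le f)) where
  isUnit := RingedSpace.isUnit_res_basicOpen _ f
  map_smul r m := LinearMap.map_smulₛₗ _ r m
  surj y := by
    have := hM.isQuasicoherent
    exact (qc_aux M hU f).1 y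
  ker x hx := by
    have := hM.isQuasicoherent
    exact (qc_aux M hU f).2 x hx

theorem isLocMap_resFun {U : S.Opens} (hU : IsAffineOpen U) (f : Γ(S, U)) :
    IsLocMap (resFun (S.basicOpen_le f)) f (resFun (S.basicOpen_le f)) := by
  have hl := hU.isLocalization_basicOpen f
  refine ⟨RingedSpace.isUnit_res_basicOpen _ f, fun r m ↦ map_mul _ r m, fun y ↦ ?_, fun x hx ↦ ?_⟩
  · obtain ⟨n, a, h⟩ := IsLocalization.Away.surj f y
    refine ⟨n, a, ?_⟩
    rw [map_pow, smul_eq_mul, mul_comm]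
    exact h.symm
  · obtain ⟨⟨_, n, rfl⟩, hn⟩ := (IsLocalization.map_eq_zero_iff (.powers f)
      Γ(S, S.basicOpen f) x).mp hx
    exact ⟨n, hn⟩

namespace LinearSection

variable {n k : ℕ} {Q : QuadricFamily S n} (s : LinearSection Q k)

theorem loc {U V : S.AffineZariskiSite} (f : Γ(S, U.toOpens)) (hf : S.basicOpen f = V.toOpens)
    (h : V.toOpens ≤ U.toOpens) :
    HypRed.Loc (Q.q U.toOpens) (appLin s.ι U.toOpens) (Q.q V.toOpens) (appLin s.ι V.toOpens)
      (res Q.E h) (res Q.L h) (res s.W h) f := by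
  obtain ⟨V, hV⟩ := V
  change S.basicOpen f = V at hf
  subst hf
  exact
  { hR := isLocMap_resFun U.2 f
    hE := isLocMap_res _ Q.isVectorBundle_E U.2 f
    hL := isLocMap_res _ Q.isVectorBundle_L U.2 f
    hW := isLocMap_res _ s.isVectorBundle U.2 f
    q_map := Q.q_res h
    ι_map := appLin_res s.ι h }

theorem perp_res {U V : S.AffineZariskiSite} (h : V ≤ U)
    (x : HypRed.perp (Q.q U.toOpens) (appLin s.ι U.toOpens)) :
    res Q.E (site_le h) x ∈
      HypRed.perp (Q.q V.toOpens) (appLin s.ι V.toOpens) := by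
  obtain ⟨f, hf⟩ := id h
  exact (s.loc f hf (site_le h)).mem_perp x x.2

theorem resFun_comp {U V T : S.Opens} (h : V ≤ U) (h' : T ≤ V) (h'' : T ≤ U) (r : Γ(S, U)) :
    resFun h'' r = resFun h' (resFun h r) :=
  congr($(S.presheaf.map_comp (homOfLE h).op (homOfLE h').op).hom r)

theorem res_comp (M : S.Modules) {U V T : S.Opens} (h : V ≤ U) (h' : T ≤ V) (h'' : T ≤ U)
    (r : Γ(M, U)) : res M h'' r = res M h' (res M h r) :=
  congr($(M.presheaf.map_comp (homOfLE h).op (homOfLE h').op) r)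

theorem resFun_id {U : S.Opens} (h : U ≤ U) (r : Γ(S, U)) : resFun h r = r :=
  congr($(S.presheaf.map_id (.op U)).hom r)

theorem res_id (M : S.Modules) {U : S.Opens} (h : U ≤ U) (r : Γ(M, U)) : res M h r = r :=
  congr($(M.presheaf.map_id (.op U)) r)

variable [IsLocallyNoetherian S]

/-- The restriction of linear forms exists (and is a localization). -/
theorem exists_dualRes {U V : S.AffineZariskiSite} (h : V ≤ U) :
    ∃ δ : s.Dual U →ₛₗ[resFun (site_le h)] s.Dual V,
      (∀ t ∈ s.forms U, t.map (Prod.map δ δ) ∈ s.forms V) ∧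
      (∀ (φ : s.Dual U) (x : HypRed.perp (Q.q U.toOpens) (appLin s.ι U.toOpens))
        (y : HypRed.perp (Q.q V.toOpens) (appLin s.ι V.toOpens)),
        res Q.E (site_le h) x = y →
        δ φ (Submodule.Quotient.mk y) =
          resFun (site_le h) (φ (Submodule.Quotient.mk x))) ∧
      ∃ f : Γ(S, U.toOpens), S.basicOpen f = V.toOpens ∧
        IsLocMap (resFun (site_le h)) f δ ∧
        ∀ t' ∈ s.forms V, ∃ a b : ℕ, ∃ t ∈ s.forms U, t.map (Prod.map δ δ) = t'.map fun p ↦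
          (resFun (site_le h) (f ^ a) • p.1,
            resFun (site_le h) (f ^ b) • p.2) := by
  obtain ⟨f, hf⟩ := id h
  have H := s.loc f hf (site_le h)
  have : IsNoetherianRing Γ(S, U.toOpens) := IsLocallyNoetherian.component_noetherian ⟨_, U.2⟩
  have := Q.isVectorBundle_E.finite _ U.2
  have := Q.isVectorBundle_L.finite _ U.2
  have := s.isVectorBundle.finite _ U.2
  obtain ⟨δ, h1, h2⟩ := IsLocMap.dual H.hR H.isLocMap_redMap
  refine ⟨δ, H.forms_map h1, fun φ x y hxy ↦ ?_, f, hf, h2, H.forms_surj h1 h2⟩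
  rw [← h1]
  exact congr_arg (δ φ) (congr_arg Submodule.Quotient.mk (Subtype.ext hxy.symm))

/-- The restriction of linear forms on `W^⊥ / W`. -/
noncomputable def dualRes {U V : S.AffineZariskiSite} (h : V ≤ U) :
    s.Dual U →ₛₗ[resFun (site_le h)] s.Dual V :=
  (s.exists_dualRes h).choose

/-- The restriction of linear forms is characterized by the compatibility with the restriction
of sections of `W^⊥`. -/
theorem dualRes_unique {U V : S.AffineZariskiSite} (h : V ≤ U) (φ : s.Dual U) (ψ : s.Dual V)
    (hψ : ∀ (x : HypRed.perp (Q.q U.toOpens) (appLin s.ι U.toOpens))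
        (y : HypRed.perp (Q.q V.toOpens) (appLin s.ι V.toOpens)),
        res Q.E (site_le h) x = y →
        ψ (Submodule.Quotient.mk y) =
          resFun (site_le h) (φ (Submodule.Quotient.mk x))) :
    s.dualRes h φ = ψ := by
  obtain ⟨f, hf⟩ := id h
  have H := s.loc f hf (site_le h)
  have := Q.isVectorBundle_L.finite _ U.2
  have := s.isVectorBundle.finite _ U.2
  refine IsLocMap.dual_unique H.isLocMap_redMap fun m ↦ ?_
  obtain ⟨x, rfl⟩ := Submodule.Quotient.mk_surjective _ m
  have h2 := (s.exists_dualRes h).choose_spec.2.1 φ x ⟨_, H.mem_perp x x.2⟩ rfl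
  exact h2.trans (hψ x ⟨_, H.mem_perp x x.2⟩ rfl).symm

theorem dualRes_apply {U V : S.AffineZariskiSite} (h : V ≤ U) (φ : s.Dual U)
    (x : HypRed.perp (Q.q U.toOpens) (appLin s.ι U.toOpens))
    (y : HypRed.perp (Q.q V.toOpens) (appLin s.ι V.toOpens))
    (hxy : res Q.E (site_le h) x = y) :
    s.dualRes h φ (Submodule.Quotient.mk y) =
      resFun (site_le h) (φ (Submodule.Quotient.mk x)) :=
  (s.exists_dualRes h).choose_spec.2.1 φ x y hxy

theorem dualRes_forms {U V : S.AffineZariskiSite} (h : V ≤ U) :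
    ∀ t ∈ s.forms U, t.map (Prod.map (s.dualRes h) (s.dualRes h)) ∈ s.forms V :=
  (s.exists_dualRes h).choose_spec.1

theorem isLocMap_coord {U V : S.AffineZariskiSite} (h : V ≤ U) :
    ∃ f, IsLocMap (resFun (site_le h)) f
      (QuadAlg.map (s.dualRes h) (s.dualRes_forms h)) ∧
      IsLocMap (resFun (site_le h)) f (resFun (site_le h)) := by
  obtain ⟨f, hf, h2, h3⟩ := (s.exists_dualRes h).choose_spec.2.2
  have H := s.loc f hf (site_le h)
  exact ⟨f, QuadAlg.isLocMap_map _ _ H.hR h2 h3, H.hR⟩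

theorem dualRes_id {U : S.AffineZariskiSite} (h : U ≤ U) (φ : s.Dual U) :
    s.dualRes h φ = φ := by
  refine s.dualRes_unique h _ _ fun x y hxy ↦ ?_
  have h1 : x = y := Subtype.ext ((res_id _ _ _).symm.trans hxy)
  rw [h1]
  exact (resFun_id _ _).symm

theorem dualRes_comp {U V T : S.AffineZariskiSite} (h : V ≤ U) (h' : T ≤ V) (h'' : T ≤ U)
    (φ : s.Dual U) : s.dualRes h'' φ = s.dualRes h' (s.dualRes h φ) := by
  refine s.dualRes_unique h'' _ _ fun x y hxy ↦ ?_
  rw [res_comp _ (site_le h) (site_le h')] at hxy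
  rw [s.dualRes_apply h' _ ⟨_, s.perp_res h x⟩ y hxy,
    s.dualRes_apply h _ x ⟨_, s.perp_res h x⟩ rfl]
  exact (resFun_comp _ _ _ _).symm

/-- The zero schemes, in the projectivizations of the modules `W^⊥ / W`, of the induced
quadratic forms, over the affine opens of `S`. -/
noncomputable def projFunctor : S.AffineZariskiSite ⥤ Scheme.{u} where
  obj U := QuadAlg.proj Γ(S, U.toOpens) (s.forms U)
  map i := QuadAlg.projMap (s.dualRes i.le) (s.dualRes_forms i.le)
    ((s.isLocMap_coord i.le).imp fun _ ↦ And.left)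
  map_id U := QuadAlg.projMap_id _ _ _ (resFun_id _) (s.dualRes_id _)
  map_comp i j := QuadAlg.projMap_comp _ _ _ _ _ _ _ _ _
    (resFun_comp _ _ _) (s.dualRes_comp _ _ _)

/-- The structure maps of `projFunctor`. -/
noncomputable def projTrans : s.projFunctor ⟶
    Scheme.AffineZariskiSite.toOpensFunctor S ⋙ S.presheaf.rightOp ⋙ Scheme.Spec where
  app U := QuadAlg.projStr Γ(S, U.toOpens) (s.forms U)
  naturality _ _ i := QuadAlg.projMap_projStr _ _ ((s.isLocMap_coord i.le).imp fun _ ↦ And.left)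

theorem projTrans_equifibered : s.projTrans.Equifibered := fun _ _ i ↦
  QuadAlg.isPullback_projMap _ _ (s.isLocMap_coord i.le)

/-- The zero schemes over the affine opens of `S` form a relative gluing datum. -/
noncomputable def gluingData : (Scheme.AffineZariskiSite.directedCover S).RelativeGluingData where
  functor := s.projFunctor
  natTrans := s.projTrans ≫ (Scheme.AffineZariskiSite.restrictIsoSpec S).inv
  equifibered := by
    have h : NatTrans.Equifibered (Scheme.AffineZariskiSite.restrictIsoSpec S).inv :=
      .of_isIso _
    exact s.projTrans_equifibered.comp h

/-- The hyperbolic reduction of the family of quadrics with respect to the section: the zero scheme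
in the projectivization of `W^⊥ / W` of the induced quadratic form. -/
noncomputable def reduction : Scheme.{u} := s.gluingData.glued

/-- The projection of the hyperbolic reduction to the base. -/
noncomputable def toBase : s.reduction ⟶ S := s.gluingData.toBase

theorem toBase_finiteType : LocallyOfFiniteType s.toBase ∧ QuasiCompact s.toBase := by
  have hU : ∀ U : S.AffineZariskiSite, LocallyOfFiniteType (s.gluingData.natTrans.app U) ∧
      QuasiCompact (s.gluingData.natTrans.app U) := by
    intro U
    have : IsNoetherianRing Γ(S, U.toOpens) := IsLocallyNoetherian.component_noetherian ⟨_, U.2⟩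
    have := Q.isVectorBundle_E.finite _ U.2
    obtain ⟨h1, h2⟩ := QuadAlg.projStr_finiteType (R := Γ(S, U.toOpens)) (J := s.forms U)
    have h4 : IsIso ((Scheme.AffineZariskiSite.restrictIsoSpec S).inv.app U) := inferInstance
    exact ⟨locallyOfFiniteType_comp_isIso _ _ h1 h4, quasiCompact_comp_isIso _ _ h2 h4⟩
  have hP := s.gluingData.isPullback_natTrans_ι_toBase
  constructor
  · obtain ⟨P, hP1, hP2⟩ := local_locallyOfFiniteType
    rw [← hP2]
    refine IsZariskiLocalAtTarget.of_openCover (P := P)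
      (Scheme.AffineZariskiSite.directedCover S) fun U ↦ ?_
    have e := (hP U).flip.isoPullback_hom_snd
    refine (P.cancel_left_of_respectsIso (hP U).flip.isoPullback.hom _).mp ?_
    change P ((hP U).flip.isoPullback.hom ≫ Limits.pullback.snd _ _)
    rw [e]
    exact (hP2 _).2 (hU U).1
  · obtain ⟨P, hP1, hP2⟩ := local_quasiCompact
    rw [← hP2]
    refine IsZariskiLocalAtTarget.of_openCover (P := P)
      (Scheme.AffineZariskiSite.directedCover S) fun U ↦ ?_
    have e := (hP U).flip.isoPullback_hom_snd
    refine (P.cancel_left_of_respectsIso (hP U).flip.isoPullback.hom _).mp ?_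
    change P ((hP U).flip.isoPullback.hom ≫ Limits.pullback.snd _ _)
    rw [e]
    exact (hP2 _).2 (hU U).2

end LinearSection

end Bundles

section GrothendieckRing

variable (F : Type u) [Field F]

/-- A scheme of finite type over the field `F`. -/
structure FTScheme where
  X : Scheme.{u}
  str : X ⟶ Spec (CommRingCat.of F)
  locallyOfFiniteType : LocallyOfFiniteType str
  quasiCompact : QuasiCompact str

variable {F}

/-- The relations that define the Grothendieck ring of varieties. -/
inductive K0Rel : FreeCommRing (FTScheme F) → Prop
  /-- Isomorphic schemes have the same class. -/
  | iso (X Y : FTScheme F) (e : X.X ≅ Y.X) (h : e.hom ≫ Y.str = X.str) :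
    K0Rel (FreeCommRing.of X - FreeCommRing.of Y)
  /-- If `Z` is a closed subscheme of `X` with open complement `U`, then `[X] = [Z] + [U]`. -/
  | scissor (X Z U : FTScheme F) (i : Z.X ⟶ X.X) (j : U.X ⟶ X.X) (hi : IsClosedImmersion i)
    (hj : IsOpenImmersion j) (hZ : i ≫ X.str = Z.str) (hU : j ≫ X.str = U.str)
    (h : IsCompl (Set.range i) (Set.range j)) :
    K0Rel (FreeCommRing.of X - (FreeCommRing.of Z + FreeCommRing.of U))
  /-- The product of classes is the class of the product over `F`. -/
  | prod (X Y P : FTScheme F) (fst : P.X ⟶ X.X) (snd : P.X ⟶ Y.X)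
    (h : IsPullback fst snd X.str Y.str) (hP : fst ≫ X.str = P.str) :
    K0Rel (FreeCommRing.of P - FreeCommRing.of X * FreeCommRing.of Y)
  /-- The class of `Spec F` is `1`. -/
  | unit (X : FTScheme F) (h : IsIso X.str) : K0Rel (FreeCommRing.of X - 1)

variable (F) in
/-- The Grothendieck ring of varieties over `F`. -/
abbrev K0Var : Type (u + 1) := FreeCommRing (FTScheme F) ⧸ Ideal.span {x | K0Rel (F := F) x}

/-- The class of a scheme of finite type over `F` in the Grothendieck ring. -/
noncomputable def FTScheme.cls (X : FTScheme F) : K0Var F :=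
  Ideal.Quotient.mk (Ideal.span {x | K0Rel (F := F) x}) (FreeCommRing.of X)

variable {S : Scheme.{u}} (p : S ⟶ Spec (CommRingCat.of F)) [LocallyOfFiniteType p]
  [QuasiCompact p] {n k : ℕ} {Q : QuadricFamily S n}

/-- The hyperbolic reduction, as a scheme of finite type over the base field. -/
noncomputable def LinearSection.reductionOver (s : LinearSection Q k) : FTScheme F :=
  have := LocallyOfFiniteType.isLocallyNoetherian p
  { X := s.reduction
    str := s.toBase ≫ p
    locallyOfFiniteType := by
      have := s.toBase_finiteType.1
      infer_instance
    quasiCompact := by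
      have := s.toBase_finiteType.2
      infer_instance }

end GrothendieckRing

/-!
The base is covered by open sets over which the two hyperbolic reductions are isomorphic, and
schemes over `S` that are isomorphic over each member of a finite open cover have the same class,
because `S` is cut into locally closed pieces each lying in one member of the cover
(`FTScheme.cls_eq_of_list_cover`).

The local isomorphisms come from Witt's theorem, which holds near a point as soon as `2` is
invertible, even for a form that degenerates there. Trivialize near the point the line bundle, so
that there is a single symmetric bilinear form `b`, and the two isotropic subbundles. By
nondegeneracy each of the two frames has dual vectors up to factors that do not vanish at the point
(`LinearSection.Nondegenerate.exists_dual_vector`). The frame vectors are then moved one by one to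
those of the other frame by reflections: if `b z y` does not vanish at the point, the reflection in
`z - y` takes the isotropic vector `z` to the isotropic vector `y`; otherwise one passes through an
isotropic vector orthogonal to neither (`exists_reflComp_eq`). All reflections are multiplied by
`b v v` to clear the denominators, and after inverting the product of these factors the composite
is an isometry of `E` that carries one subbundle to the other (`LinearSection.exists_isometry`).
It induces an isomorphism of the modules `W^⊥ / W` which respects the quadratic forms, hence of the
reductions (`HypRed.exists_proj_iso`).
-/

/-! ### Scaled reflections and Witt's theorem -/

section Witt

variable {A E : Type*} [CommRing A] [AddCommGroup E] [Module A E] (b : E →ₗ[A] E →ₗ[A] A)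

/-- The reflection in the vector `v`, multiplied by `b v v` so that it is defined over any ring,
whether or not `b v v` is invertible. -/
def scaledReflection (v : E) : E →ₗ[A] E :=
  b v v • LinearMap.id - (2 : A) • (b v).smulRight v

theorem scaledReflection_apply (v e : E) :
    scaledReflection b v e = b v v • e - (2 * b v e) • v := by
  simp [scaledReflection, mul_smul]

/-- The composite of the scaled reflections in the vectors of a list, the last one applied
first. -/
def reflComp (l : List E) : E →ₗ[A] E := l.foldr (fun v T ↦ scaledReflection b v ∘ₗ T) LinearMap.id

/-- The product of the scaling factors of the scaled reflections in the vectors of a list. -/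
def reflScale (l : List E) : A := (l.map fun v ↦ b v v).prod

@[simp] theorem reflComp_nil (e : E) : reflComp b [] e = e := rfl

@[simp] theorem reflComp_cons (v : E) (l : List E) (e : E) :
    reflComp b (v :: l) e = scaledReflection b v (reflComp b l e) := rfl

@[simp] theorem reflScale_nil : reflScale b [] = 1 := rfl

@[simp] theorem reflScale_cons (v : E) (l : List E) :
    reflScale b (v :: l) = b v v * reflScale b l := by simp [reflScale]

theorem reflComp_append (l l' : List E) (e : E) :
    reflComp b (l ++ l') e = reflComp b l (reflComp b l' e) := by
  induction l with
  | nil => rfl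
  | cons v l ih => simp [ih]

theorem reflScale_append (l l' : List E) :
    reflScale b (l ++ l') = reflScale b l * reflScale b l' := by simp [reflScale]

theorem reflScale_reverse (l : List E) : reflScale b l.reverse = reflScale b l := by
  simp [reflScale, List.prod_reverse]

variable {b} in
theorem reflComp_map {A' E' : Type*} [CommRing A'] [AddCommGroup E'] [Module A' E']
    {b' : E' →ₗ[A'] E' →ₗ[A'] A'} {σ : A →+* A'} {ρ : E →ₛₗ[σ] E'}
    (h : ∀ x y, b' (ρ x) (ρ y) = σ (b x y)) (l : List E) (e : E) :
    reflComp b' (l.map ρ) (ρ e) = ρ (reflComp b l e) := by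
  induction l with
  | nil => rfl
  | cons v l ih => simp [ih, scaledReflection_apply, h, LinearMap.map_smulₛₗ, map_ofNat]

variable {b} in
theorem reflScale_map {A' E' : Type*} [CommRing A'] [AddCommGroup E'] [Module A' E']
    {b' : E' →ₗ[A'] E' →ₗ[A'] A'} {σ : A →+* A'} {ρ : E →ₛₗ[σ] E'}
    (h : ∀ x y, b' (ρ x) (ρ y) = σ (b x y)) (l : List E) :
    reflScale b' (l.map ρ) = σ (reflScale b l) := by
  induction l with
  | nil => simp
  | cons v l ih => simp [ih, h]

theorem scaledReflection_of_orthogonal {v e : E} (h : b v e = 0) :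
    scaledReflection b v e = b v v • e := by
  simp [scaledReflection_apply, h]

variable {b}

theorem bilin_scaledReflection (hb : ∀ x y, b x y = b y x) (v x y : E) :
    b (scaledReflection b v x) (scaledReflection b v y) = b v v ^ 2 * b x y := by
  simp only [scaledReflection_apply, map_sub, map_smul, LinearMap.sub_apply, LinearMap.smul_apply,
    smul_eq_mul, hb x v]
  ring

theorem scaledReflection_scaledReflection (v x : E) :
    scaledReflection b v (scaledReflection b v x) = b v v ^ 2 • x := by
  simp only [scaledReflection_apply, map_sub, map_smul]
  module

theorem reflComp_reverse (l : List E) (x : E) :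
    reflComp b l.reverse (reflComp b l x) = reflScale b l ^ 2 • x := by
  induction l generalizing x with
  | nil => simp
  | cons v l ih =>
    rw [List.reverse_cons, reflComp_append, reflComp_cons, reflComp_cons, reflComp_nil,
      scaledReflection_scaledReflection, map_smul, ih, smul_smul, reflScale_cons, mul_pow]

variable (hb : ∀ x y, b x y = b y x)

include hb

theorem bilin_reflComp (l : List E) (x y : E) :
    b (reflComp b l x) (reflComp b l y) = reflScale b l ^ 2 * b x y := by
  induction l with
  | nil => simp
  | cons v l ih =>
    rw [reflComp_cons, reflComp_cons, bilin_scaledReflection hb, ih, reflScale_cons]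
    ring

/-- If the scaling factor is invertible, a composite of scaled reflections is a multiple of an
isometry. -/
theorem exists_isometry_of_isUnit_reflScale (l : List E) (hl : IsUnit (reflScale b l)) :
    ∃ g : E ≃ₗ[A] E, (∀ x y, b (g x) (g y) = b x y) ∧
      ∀ x, reflScale b l • g x = reflComp b l x := by
  obtain ⟨c, hc⟩ := hl
  have h1 : (↑c⁻¹ : A) * reflScale b l = 1 := by rw [← hc, Units.inv_mul]
  have h2 : ((↑c⁻¹ : A) * ↑c⁻¹) * reflScale b l ^ 2 = 1 := by
    linear_combination ((↑c⁻¹ : A) * reflScale b l + 1) * h1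
  have key : ∀ x, (↑c⁻¹ : A) • reflComp b l.reverse ((↑c⁻¹ : A) • reflComp b l x) = x := by
    intro x
    rw [map_smul, reflComp_reverse, smul_smul, smul_smul, h2, one_smul]
  have key' : ∀ x, (↑c⁻¹ : A) • reflComp b l ((↑c⁻¹ : A) • reflComp b l.reverse x) = x := by
    intro x
    have := reflComp_reverse (b := b) l.reverse x
    rw [List.reverse_reverse] at this
    rw [map_smul, this, reflScale_reverse, smul_smul, smul_smul, h2, one_smul]
  refine ⟨LinearEquiv.ofLinearMap ((↑c⁻¹ : A) • reflComp b l) ((↑c⁻¹ : A) • reflComp b l.reverse)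
    (LinearMap.ext key') (LinearMap.ext key), fun x y ↦ ?_, fun x ↦ ?_⟩
  · change b ((↑c⁻¹ : A) • reflComp b l x) ((↑c⁻¹ : A) • reflComp b l y) = _
    rw [map_smul, map_smul, LinearMap.smul_apply, bilin_reflComp hb, smul_eq_mul, smul_eq_mul]
    linear_combination b x y * h2
  · change reflScale b l • (↑c⁻¹ : A) • reflComp b l x = _
    rw [smul_smul, mul_comm, h1, one_smul]

/-- The reflection in `x - y` carries the isotropic vector `x` to the isotropic vector `y`. -/
theorem scaledReflection_sub {x y : E} (hx : b x x = 0) (hy : b y y = 0) :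
    scaledReflection b (x - y) x = b (x - y) (x - y) • y := by
  simp only [scaledReflection_apply, map_sub, LinearMap.sub_apply, hx, hy, hb y x]
  module

variable {Ω : Type*} [Field Ω] (φ : A →+* Ω) (h2 : φ 2 ≠ 0)

include h2

/-- Given isotropic vectors `z` and `y` orthogonal to `K`, each of which pairs nontrivially at the
point `φ` with a vector orthogonal to `K`, a composite of at most two scaled reflections acts on `K`
by scaling and carries `z` to the multiple of `y` by the same factor. -/
theorem exists_reflComp_eq_of_orthogonal {K : Set E} {z y : E} (hz : b z z = 0) (hy : b y y = 0)
    (hKz : ∀ k ∈ K, b z k = 0) (hKy : ∀ k ∈ K, b y k = 0)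
    (hez : ∃ e, (∀ k ∈ K, b e k = 0) ∧ φ (b e z) ≠ 0)
    (hey : ∃ e, (∀ k ∈ K, b e k = 0) ∧ φ (b e y) ≠ 0) :
    ∃ l : List E, φ (reflScale b l) ≠ 0 ∧ (∀ k ∈ K, reflComp b l k = reflScale b l • k) ∧
      reflComp b l z = reflScale b l • y := by
  by_cases hzy : φ (b z y) = 0
  · -- `z` and `y` are orthogonal at `φ`; pass through an isotropic vector `u` that is
    -- orthogonal to neither
    obtain ⟨a, haK, haz, hay⟩ : ∃ a, (∀ k ∈ K, b a k = 0) ∧ φ (b a z) ≠ 0 ∧ φ (b a y) ≠ 0 := by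
      obtain ⟨e, heK, he⟩ := hez
      obtain ⟨e', heK', he'⟩ := hey
      by_cases h1 : φ (b e y) = 0
      · by_cases h3 : φ (b e' z) = 0
        · refine ⟨e + e', fun k hk ↦ by simp [heK k hk, heK' k hk], ?_, ?_⟩
          · simpa [h3] using he
          · simpa [h1] using he'
        · exact ⟨e', heK', h3, he'⟩
      · exact ⟨e, heK, he, h1⟩
    let u : E := (2 * b a z) • a - b a a • z
    have huK : ∀ k ∈ K, b u k = 0 := fun k hk ↦ by simp [u, haK k hk, hKz k hk]
    have huu : b u u = 0 := by
      simp only [u, map_sub, map_smul, LinearMap.sub_apply, LinearMap.smul_apply, smul_eq_mul, hz,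
        hb z a]
      ring
    have huz : φ (b u z) ≠ 0 := by
      have : b u z = 2 * (b a z * b a z) := by
        simp only [u, map_sub, map_smul, LinearMap.sub_apply, LinearMap.smul_apply, smul_eq_mul, hz]
        ring
      rw [this, map_mul, map_mul]
      exact mul_ne_zero h2 (mul_ne_zero haz haz)
    have huy : φ (b u y) ≠ 0 := by
      have : b u y = 2 * (b a z * b a y) - b a a * b z y := by
        simp only [u, map_sub, map_smul, LinearMap.sub_apply, LinearMap.smul_apply, smul_eq_mul]
        ring
      rw [this, map_sub, map_mul, map_mul, map_mul, hzy, mul_zero, sub_zero]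
      exact mul_ne_zero h2 (mul_ne_zero haz hay)
    clear_value u
    refine ⟨[u - y, z - u], ?_, fun k hk ↦ ?_, ?_⟩
    · have e1 : b (u - y) (u - y) = -(2 * b u y) := by
        simp only [map_sub, LinearMap.sub_apply, huu, hy, hb y u]; ring
      have e2 : b (z - u) (z - u) = -(2 * b u z) := by
        simp only [map_sub, LinearMap.sub_apply, huu, hz, hb z u]; ring
      simp only [reflScale_cons, reflScale_nil, mul_one, e1, e2, map_mul, map_neg]
      exact mul_ne_zero (neg_ne_zero.mpr (mul_ne_zero h2 huy))
        (neg_ne_zero.mpr (mul_ne_zero h2 huz))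
    · rw [reflComp_cons, reflComp_cons, reflComp_nil,
        scaledReflection_of_orthogonal b (v := z - u) (by simp [hKz k hk, huK k hk]), map_smul,
        scaledReflection_of_orthogonal b (by simp [hKy k hk, huK k hk]), smul_smul]
      simp [mul_comm]
    · rw [reflComp_cons, reflComp_cons, reflComp_nil, scaledReflection_sub hb hz huu, map_smul,
        scaledReflection_sub hb huu hy, smul_smul]
      simp [mul_comm]
  · refine ⟨[z - y], ?_, fun k hk ↦ ?_, ?_⟩
    · have e1 : b (z - y) (z - y) = -(2 * b z y) := by
        simp only [map_sub, LinearMap.sub_apply, hz, hy, hb y z]; ring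
      simp only [reflScale_cons, reflScale_nil, mul_one, e1, map_mul, map_neg]
      exact neg_ne_zero.mpr (mul_ne_zero h2 hzy)
    · rw [reflComp_cons, reflComp_nil,
        scaledReflection_of_orthogonal b (by simp [hKy k hk, hKz k hk])]
      simp
    · rw [reflComp_cons, reflComp_nil, scaledReflection_sub hb hz hy]
      simp

/-- Witt's theorem near a point: two isotropic families of vectors of the same length, both
nondegenerate at the point `φ`, are carried to each other by a composite of scaled reflections
whose scaling factor does not vanish at `φ`. The vectors are moved to their places one by one. -/
theorem exists_reflComp_eq {m : ℕ} {w w' : Fin m → E} (hw : ∀ i j, b (w i) (w j) = 0)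
    (hw' : ∀ i j, b (w' i) (w' j) = 0)
    (he : ∀ i, ∃ e, (∀ j ≠ i, b e (w j) = 0) ∧ φ (b e (w i)) ≠ 0)
    (he' : ∀ i, ∃ e, (∀ j ≠ i, b e (w' j) = 0) ∧ φ (b e (w' i)) ≠ 0) :
    ∃ l : List E, φ (reflScale b l) ≠ 0 ∧ ∀ i, reflComp b l (w i) = reflScale b l • w' i := by
  suffices ∀ t ≤ m, ∃ l : List E, φ (reflScale b l) ≠ 0 ∧
      ∀ i : Fin m, (i : ℕ) < t → reflComp b l (w i) = reflScale b l • w' i by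
    obtain ⟨l, h, h'⟩ := this m le_rfl
    exact ⟨l, h, fun i ↦ h' i i.2⟩
  intro t
  induction t with
  | zero => exact fun _ ↦ ⟨[], by simp, by simp⟩
  | succ t ih =>
    intro ht
    obtain ⟨l, hl, hlw⟩ := ih (by omega)
    let i₀ : Fin m := ⟨t, ht⟩
    obtain ⟨l', h1, h3, h4⟩ := exists_reflComp_eq_of_orthogonal hb φ h2
      (K := {k | ∃ i : Fin m, (i : ℕ) < t ∧ k = reflComp b l (w i)})
      (z := reflComp b l (w i₀)) (y := reflScale b l • w' i₀)
      (by rw [bilin_reflComp hb, hw, mul_zero])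
      (by simp [hw'])
      (by rintro _ ⟨i, -, rfl⟩
          rw [bilin_reflComp hb, hw, mul_zero])
      (by rintro _ ⟨i, hi, rfl⟩
          simp [hlw i hi, hw'])
      (by obtain ⟨e, h5, h6⟩ := he i₀
          refine ⟨reflComp b l e, ?_, ?_⟩
          · rintro _ ⟨i, hi, rfl⟩
            rw [bilin_reflComp hb, h5 i (by rintro rfl; exact lt_irrefl _ hi), mul_zero]
          · rw [bilin_reflComp hb, map_mul, map_pow]
            exact mul_ne_zero (pow_ne_zero _ hl) h6)
      (by obtain ⟨e, h5, h6⟩ := he' i₀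
          refine ⟨e, ?_, ?_⟩
          · rintro _ ⟨i, hi, rfl⟩
            rw [hlw i hi, map_smul, h5 i (by rintro rfl; exact lt_irrefl _ hi), smul_zero]
          · rw [map_smul, smul_eq_mul, map_mul]
            exact mul_ne_zero hl h6)
    refine ⟨l' ++ l, ?_, fun i hi ↦ ?_⟩
    · rw [reflScale_append, map_mul]
      exact mul_ne_zero h1 hl
    · rw [reflComp_append, reflScale_append, mul_smul]
      rcases Nat.lt_succ_iff_lt_or_eq.mp hi with hi | hi
      · rw [h3 _ ⟨i, hi, rfl⟩, hlw i hi]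
      · obtain rfl : i = i₀ := Fin.ext hi
        exact h4

end Witt

/-! ### Isometric submodules have isomorphic reductions -/

namespace QuadAlg

variable {R D D' : Type u} [CommRing R] [AddCommGroup D] [Module R D] {J : Set (List (D × D))}
  [AddCommGroup D'] [Module R D'] {J' : Set (List (D' × D'))}

theorem exists_isLocMap_map_equiv (δ : D ≃ₗ[R] D')
    (hδ : ∀ t ∈ J, t.map (Prod.map (δ : D →ₗ[R] D') (δ : D →ₗ[R] D')) ∈ J')
    (hδ' : ∀ t ∈ J', t.map (Prod.map (δ.symm : D' →ₗ[R] D) (δ.symm : D' →ₗ[R] D)) ∈ J) :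
    ∃ f, IsLocMap (RingHom.id R) f (map (J := J) (J' := J') (δ : D →ₗ[R] D') hδ) := by
  refine ⟨1, isLocMap_map _ _ ⟨isUnit_one, fun _ _ ↦ rfl, fun y ↦ ⟨0, y, by simp⟩,
    fun x hx ↦ ⟨0, by simpa using hx⟩⟩ ⟨isUnit_one, fun r m ↦ by simp,
    fun y ↦ ⟨0, δ.symm y, by simp⟩, fun x hx ↦ ⟨0, by simpa using hx⟩⟩ fun t ht ↦ ?_⟩
  refine ⟨0, 0, _, hδ' t ht, ?_⟩
  rw [List.map_map]
  refine List.map_congr_left fun p _ ↦ ?_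
  exact Prod.ext ((δ.apply_symm_apply _).trans (by simp)) ((δ.apply_symm_apply _).trans (by simp))

/-- An isomorphism of the modules of linear forms that identifies the quadratic equations induces
an isomorphism of the zero schemes over the base. -/
theorem exists_proj_iso (δ : D ≃ₗ[R] D')
    (hδ : ∀ t ∈ J, t.map (Prod.map (δ : D →ₗ[R] D') (δ : D →ₗ[R] D')) ∈ J')
    (hδ' : ∀ t ∈ J', t.map (Prod.map (δ.symm : D' →ₗ[R] D) (δ.symm : D' →ₗ[R] D)) ∈ J) :
    ∃ e : proj R J ≅ proj R J', e.hom ≫ projStr R J' = projStr R J := by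
  have h := exists_isLocMap_map_equiv δ hδ hδ'
  have h' := exists_isLocMap_map_equiv δ.symm hδ' hδ
  have hid : ∀ {D : Type u} [AddCommGroup D] [Module R D] (J : Set (List (D × D))),
      ∃ hJ : ∀ t ∈ J, t.map (Prod.map (LinearMap.id : D →ₗ[R] D) (LinearMap.id : D →ₗ[R] D)) ∈ J,
        ∃ f, IsLocMap (RingHom.id R) f (map (J := J) (J' := J) (LinearMap.id : D →ₗ[R] D) hJ) := by
    intro D _ _ J
    have hJ : ∀ t ∈ J,
        t.map (Prod.map (LinearMap.id : D →ₗ[R] D) (LinearMap.id : D →ₗ[R] D)) ∈ J :=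
      fun t ht ↦ by simpa using ht
    exact ⟨hJ, exists_isLocMap_map_equiv (.refl R D) hJ hJ⟩
  refine ⟨⟨projMap _ hδ' h', projMap _ hδ h, ?_, ?_⟩, ?_⟩
  · obtain ⟨hJ, hl⟩ := hid J
    rw [← projMap_comp _ hδ _ hδ' _ hJ h h' hl (fun _ ↦ rfl) (fun d ↦ by simp)]
    exact projMap_id _ _ _ (fun _ ↦ rfl) (fun _ ↦ rfl)
  · obtain ⟨hJ, hl⟩ := hid J'
    rw [← projMap_comp _ hδ' _ hδ _ hJ h' h hl (fun _ ↦ rfl) (fun d ↦ by simp)]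
    exact projMap_id _ _ _ (fun _ ↦ rfl) (fun _ ↦ rfl)
  · have := projMap_projStr _ hδ' h'
    change projMap _ hδ' h' ≫ _ = _
    rw [this]
    change _ ≫ Spec.map (𝟙 _) = _
    rw [Spec.map_id, Category.comp_id]

end QuadAlg

namespace HypRed

variable {R E L W W' : Type u} [CommRing R] [AddCommGroup E] [Module R E] [AddCommGroup L]
  [Module R L] [AddCommGroup W] [Module R W] [AddCommGroup W'] [Module R W']
  {q : L →ₗ[R] E →ₗ[R] E →ₗ[R] R} {ι : W →ₗ[R] E} {ι' : W' →ₗ[R] E}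

theorem map_perp {g : E ≃ₗ[R] E} (hg : ∀ l x y, q l (g x) (g y) = q l x y)
    (hW : (LinearMap.range ι).map (g : E →ₗ[R] E) = LinearMap.range ι') :
    (perp q ι).map (g : E →ₗ[R] E) = perp q ι' := by
  ext x
  constructor
  · rintro ⟨x, hx, rfl⟩ l w'
    obtain ⟨_, ⟨w, rfl⟩, hw⟩ : ι' w' ∈ (LinearMap.range ι).map (g : E →ₗ[R] E) :=
      hW ▸ LinearMap.mem_range_self ι' w'
    rw [← hw]
    exact (hg _ _ _).trans (hx l w)
  · intro hx
    refine ⟨g.symm x, fun l w ↦ ?_, g.apply_symm_apply x⟩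
    obtain ⟨w', hw'⟩ : g (ι w) ∈ LinearMap.range ι' := hW ▸ ⟨ι w, ⟨w, rfl⟩, rfl⟩
    rw [← hg, g.apply_symm_apply, ← hw', hx]

/-- The isomorphism `W^⊥ / W ≃ W'^⊥ / W'` induced by an isometry that carries `W` to `W'`. -/
noncomputable def redEquiv (g : E ≃ₗ[R] E) (hg : ∀ l x y, q l (g x) (g y) = q l x y)
    (hW : (LinearMap.range ι).map (g : E →ₗ[R] E) = LinearMap.range ι') :
    Red q ι ≃ₗ[R] Red q ι' :=
  Submodule.Quotient.equiv _ _ (g.submoduleMap _ ≪≫ₗ LinearEquiv.ofEq _ _ (map_perp hg hW)) <| by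
    ext ⟨x, hx⟩
    constructor
    · rintro ⟨y, hy, hyx⟩
      obtain rfl : g y = x := congr_arg Subtype.val hyx
      exact hW ▸ ⟨_, hy, rfl⟩
    · intro hx'
      obtain ⟨y, hy, hyx⟩ : x ∈ (LinearMap.range ι).map (g : E →ₗ[R] E) := hW ▸ hx'
      obtain ⟨z, hz, hzx⟩ : x ∈ (perp q ι).map (g : E →ₗ[R] E) := map_perp hg hW ▸ hx
      obtain rfl : y = z := g.injective (hyx.trans hzx.symm)
      exact ⟨⟨y, hz⟩, hy, Subtype.ext hyx⟩

theorem redEquiv_mk (g : E ≃ₗ[R] E) (hg : ∀ l x y, q l (g x) (g y) = q l x y)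
    (hW : (LinearMap.range ι).map (g : E →ₗ[R] E) = LinearMap.range ι') (x : perp q ι)
    (y : perp q ι') (h : g x = y) :
    redEquiv g hg hW (Submodule.Quotient.mk x) = Submodule.Quotient.mk y :=
  congr_arg Submodule.Quotient.mk (Subtype.ext h)

/-- An isometry that carries `W` to `W'` carries the equations of the reduction along `W` to those
of the reduction along `W'`. -/
theorem map_mem_forms {g : E ≃ₗ[R] E} (hg : ∀ l x y, q l (g x) (g y) = q l x y)
    {δ : Module.Dual R (Red q ι) →ₗ[R] Module.Dual R (Red q ι')} {ε : Red q ι' → Red q ι}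
    (hε : ∀ (x : perp q ι) (y : perp q ι'), g x = y →
      ε (Submodule.Quotient.mk y) = Submodule.Quotient.mk x)
    (hp : ∀ y : perp q ι', g.symm y ∈ perp q ι)
    (hδ : ∀ φ y, δ φ y = φ (ε y)) {t} (ht : t ∈ forms q ι) :
    t.map (Prod.map δ δ) ∈ forms q ι' := by
  obtain ⟨l, hl⟩ := ht
  refine ⟨l, fun x y ↦ ?_⟩
  have hx := hε ⟨_, hp x⟩ x (g.apply_symm_apply _)
  have hy := hε ⟨_, hp y⟩ y (g.apply_symm_apply _)
  have := hl ⟨_, hp x⟩ ⟨_, hp y⟩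
  rw [← hg, g.apply_symm_apply, g.apply_symm_apply] at this
  rw [← this, List.map_map]
  congr 1
  refine List.map_congr_left fun p _ ↦ ?_
  simp only [Function.comp_apply, Prod.map_fst, Prod.map_snd, hδ, hx, hy]

/-- An isometry that carries `W` to `W'` induces an isomorphism of the hyperbolic reductions
over the base. -/
theorem exists_proj_iso (g : E ≃ₗ[R] E) (hg : ∀ l x y, q l (g x) (g y) = q l x y)
    (hW : (LinearMap.range ι).map (g : E →ₗ[R] E) = LinearMap.range ι') :
    ∃ e : QuadAlg.proj R (forms q ι) ≅ QuadAlg.proj R (forms q ι'),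
      e.hom ≫ QuadAlg.projStr R (forms q ι') = QuadAlg.projStr R (forms q ι) := by
  have hg' : ∀ l x y, q l (g.symm x) (g.symm y) = q l x y := fun l x y ↦ by
    rw [← hg, g.apply_symm_apply, g.apply_symm_apply]
  have hp := map_perp hg hW
  refine QuadAlg.exists_proj_iso (redEquiv g hg hW).symm.dualMap (fun t ht ↦ ?_) (fun t ht ↦ ?_)
  · refine map_mem_forms hg (ε := (redEquiv g hg hW).symm) (fun x y h ↦ ?_) (fun y ↦ ?_)
      (fun φ y ↦ rfl) ht
    · rw [LinearEquiv.symm_apply_eq, redEquiv_mk g hg hW x y h]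
    · obtain ⟨z, hz, hzy⟩ : (y : E) ∈ (perp q ι).map (g : E →ₗ[R] E) := by
        rw [hp]; exact y.2
      rw [← hzy]
      simpa using hz
  · refine map_mem_forms hg' (ε := redEquiv g hg hW) (fun x y h ↦ ?_) (fun y ↦ ?_)
      (fun φ y ↦ rfl) ht
    · exact redEquiv_mk g hg hW y x (by rw [← h, g.apply_symm_apply])
    · rw [← hp]
      exact ⟨y, y.2, rfl⟩

end HypRed

/-! ### Local frames -/

/-- If the vectors `β e`, for `e` in `E`, span the fibre at the point `A → Ω`, then near this point
each coordinate can be isolated: there is an `e` for which only the `i`-th entry of `β e` is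
non-zero, and this entry does not vanish at the point. -/
theorem exists_forall_ne_eq_zero_of_span {A E Ω : Type*} [CommRing A] [AddCommGroup E] [Module A E]
    [Field Ω] (φ : A →+* Ω) {m : ℕ} (β : E →ₗ[A] Fin m → A)
    (h : ∀ v : Fin m → Ω, v ≠ 0 → ∃ e, ∑ j, v j * φ (β e j) ≠ 0) (i : Fin m) :
    ∃ e, (∀ j ≠ i, β e j = 0) ∧ φ (β e i) ≠ 0 := by
  classical
  let s : Set (Fin m → Ω) := Set.range fun e j ↦ φ (β e j)
  have hs : ⊤ ≤ Submodule.span Ω s := by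
    by_contra hlt
    obtain ⟨f, hf, hle⟩ := Submodule.exists_le_ker_of_lt_top _
      (lt_top_iff_ne_top.mpr fun e ↦ hlt e.ge)
    have hfx : ∀ x, f x = ∑ j, f (Pi.single j 1) * x j := fun x ↦ by
      conv_lhs => rw [← LinearMap.sum_single_apply (φ := fun _ ↦ Ω) (v := x)]
      rw [map_sum]
      refine Finset.sum_congr rfl fun j _ ↦ ?_
      rw [mul_comm, ← smul_eq_mul, ← map_smul]
      congr 1
      ext k
      by_cases hk : k = j
      · subst hk; simp
      · simp [hk]
    obtain ⟨e, he⟩ := h (fun j ↦ f (Pi.single j 1)) fun h0 ↦ hf (LinearMap.ext fun x ↦ by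
      rw [hfx]
      simp [funext_iff] at h0
      simp [h0])
    refine he ?_
    rw [← hfx fun j ↦ φ (β e j)]
    exact hle (Submodule.subset_span ⟨e, rfl⟩)
  let B₀ := Module.Basis.ofSpan hs
  let B := B₀.reindex (B₀.indexEquiv (Pi.basisFun Ω (Fin m)))
  have hB : ∀ k, ∃ e, (fun j ↦ φ (β e j)) = B k := fun k ↦ by
    have : B k ∈ s := Module.Basis.ofSpan_subset hs
      ⟨(B₀.indexEquiv (Pi.basisFun Ω (Fin m))).symm k, (B₀.reindex_apply _ _).symm⟩
    exact this
  choose e he using hB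
  -- `β (e 1), …, β (e m)` is a basis at the point; Cramer's rule inverts the matrix up to its
  -- determinant
  let M : Matrix (Fin m) (Fin m) A := Matrix.of fun k j ↦ β (e k) j
  have hM : φ M.det ≠ 0 := by
    have h1 : LinearIndependent Ω (φ.mapMatrix M).row := by
      have : (φ.mapMatrix M).row = B := funext fun k ↦ (he k)
      rw [this]
      exact B.linearIndependent
    rw [RingHom.map_det]
    exact ((Matrix.isUnit_iff_isUnit_det _).mp
      (Matrix.linearIndependent_rows_iff_isUnit.mp h1)).ne_zero
  have key : ∀ j, β (∑ k, M.adjugate i k • e k) j = (M.adjugate * M) i j := fun j ↦ by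
    rw [map_sum, Finset.sum_apply, Matrix.mul_apply]
    refine Finset.sum_congr rfl fun k _ ↦ ?_
    simp [M]
  refine ⟨∑ k, M.adjugate i k • e k, fun j hj ↦ ?_, ?_⟩
  · rw [key, Matrix.adjugate_mul, Matrix.smul_apply, Matrix.one_apply_ne hj.symm, smul_zero]
  · rw [key, Matrix.adjugate_mul, Matrix.smul_apply, Matrix.one_apply_eq, smul_eq_mul, mul_one]
    exact hM

namespace IsLocMap

variable {R R' M M' : Type u} [CommRing R] [CommRing R'] [AddCommGroup M] [Module R M]
  [AddCommGroup M'] [Module R' M'] {σ : R →+* R'} {f : R} {ρ : M →ₛₗ[σ] M'}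

attribute [local instance] RingHomInvPair.of_ringEquiv in
theorem free (hσ : IsLocMap σ f σ) (h : IsLocMap σ f ρ)
    [Module.Free (Localization.Away f) (LocalizedModule.Away f M)] : Module.Free R' M' := by
  let _ := σ.toAlgebra
  let _ : Module R M' := Module.compHom M' σ
  have : IsScalarTower R R' M' := ⟨fun a b c ↦ by rw [Algebra.smul_def, mul_smul]; rfl⟩
  have := hσ.isLocalization
  let ρ' : M →ₗ[R] M' :=
    { toFun := ρ, map_add' := map_add ρ, map_smul' := fun r d ↦ ρ.map_smulₛₗ r d }
  have h1 : IsLocalizedModule (.powers f) ρ' := h.isLocalizedModule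
  set e := (IsLocalization.algEquiv (.powers f) (Localization.Away f) R').toRingEquiv
  refine (Module.Free.iff_of_equiv (σ := (e : Localization.Away f →+* R'))
    (M := LocalizedModule.Away f M)
    { __ := IsLocalizedModule.iso (.powers f) ρ', map_smul' := ?_ }).mp inferInstance
  intro r x
  obtain ⟨r, s, rfl⟩ := IsLocalization.exists_mk'_eq (.powers f) r
  apply ((Module.End.isUnit_iff _).mp (IsLocalizedModule.map_units ρ' s)).1
  have h2 : (s : R) • IsLocalization.mk' (Localization.Away f) r s • x = r • x := by
    rw [← smul_assoc, Algebra.smul_def, IsLocalization.mk'_spec', algebraMap_smul]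
  have h3 := congr_arg (IsLocalizedModule.iso (.powers f) ρ') h2
  rw [LinearEquiv.map_smul, LinearEquiv.map_smul] at h3
  simpa [e, ← smul_assoc] using h3

theorem exists_basis (hσ : IsLocMap σ f σ) (h : IsLocMap σ f ρ) {ι : Type*}
    (v : Module.Basis ι R M) : ∃ v' : Module.Basis ι R' M', ∀ i, v' i = ρ (v i) := by
  let _ := σ.toAlgebra
  let _ : Module R M' := Module.compHom M' σ
  have : IsScalarTower R R' M' := ⟨fun a b c ↦ by rw [Algebra.smul_def, mul_smul]; rfl⟩
  have := hσ.isLocalization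
  let ρ' : M →ₗ[R] M' :=
    { toFun := ρ, map_add' := map_add ρ, map_smul' := fun r d ↦ ρ.map_smulₛₗ r d }
  have h1 : IsLocalizedModule (.powers f) ρ' := h.isLocalizedModule
  exact ⟨v.ofIsLocalizedModule R' (.powers f) ρ', v.ofIsLocalizedModule_apply R' (.powers f) ρ'⟩

end IsLocMap

section Frames

variable {S : Scheme.{u}}

theorem mem_basicOpen_iff_notMem_primeIdealOf {U : S.Opens} (hU : IsAffineOpen U) {x : S}
    (hx : x ∈ U) (f : Γ(S, U)) :
    x ∈ S.basicOpen f ↔ f ∉ (hU.primeIdealOf ⟨x, hx⟩).asIdeal := by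
  rw [← PrimeSpectrum.mem_basicOpen, ← hU.fromSpec_preimage_basicOpen]
  change _ ↔ hU.fromSpec (hU.primeIdealOf ⟨x, hx⟩) ∈ S.basicOpen f
  rw [hU.fromSpec_primeIdealOf]

theorem IsVectorBundle.exists_basis_basicOpen {M : S.Modules} {r : ℕ} (hM : IsVectorBundle M r)
    {U : S.Opens} (hU : IsAffineOpen U) {x : S} (hx : x ∈ U) :
    ∃ f : Γ(S, U), x ∈ S.basicOpen f ∧
      Nonempty (Module.Basis (Fin r) Γ(S, S.basicOpen f) Γ(M, S.basicOpen f)) := by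
  have := hM.finite U hU
  have := hM.projective U hU
  have : Module.FinitePresentation Γ(S, U) Γ(M, U) := Module.finitePresentation_of_projective _ _
  let P := (hU.primeIdealOf ⟨x, hx⟩).asIdeal
  have : Module.Free (Localization.AtPrime P) (LocalizedModule P.primeCompl Γ(M, U)) :=
    Module.free_of_flat_of_isLocalRing
  obtain ⟨f, hfP, hf, -⟩ := Module.FinitePresentation.exists_free_localizedModule_powers
    P.primeCompl (LocalizedModule.mkLinearMap P.primeCompl Γ(M, U)) (Localization.AtPrime P)
  have hxf : x ∈ S.basicOpen f := (mem_basicOpen_iff_notMem_primeIdealOf hU hx f).mpr hfP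
  have hfree := (isLocMap_resFun hU f).free (isLocMap_res M hM hU f)
  have hV := hU.basicOpen f
  have := hM.finite _ hV
  have : Nontrivial Γ(S, S.basicOpen f) := (hV.primeIdealOf ⟨x, hxf⟩).nontrivial
  refine ⟨f, hxf, ⟨Module.finBasisOfFinrankEq _ _ ?_⟩⟩
  rw [← hM.rank _ hV (hV.primeIdealOf ⟨x, hxf⟩), Module.rankAtStalk_eq_finrank_of_free]
  rfl

theorem IsVectorBundle.basis_basicOpen {M : S.Modules} {r : ℕ} (hM : IsVectorBundle M r)
    {U : S.Opens} (hU : IsAffineOpen U) (f : Γ(S, U)) :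
    Nonempty (Module.Basis (Fin r) Γ(S, U) Γ(M, U)) →
      Nonempty (Module.Basis (Fin r) Γ(S, S.basicOpen f) Γ(M, S.basicOpen f)) := fun ⟨v⟩ ↦
  ⟨((isLocMap_resFun hU f).exists_basis (isLocMap_res M hM hU f) v).choose⟩

/-- Three vector bundles are simultaneously trivial near a point. -/
theorem exists_bases {M₁ M₂ M₃ : S.Modules} {r₁ r₂ r₃ : ℕ} (h₁ : IsVectorBundle M₁ r₁)
    (h₂ : IsVectorBundle M₂ r₂) (h₃ : IsVectorBundle M₃ r₃) (x : S) :
    ∃ V : S.Opens, IsAffineOpen V ∧ x ∈ V ∧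
      Nonempty (Module.Basis (Fin r₁) Γ(S, V) Γ(M₁, V)) ∧
      Nonempty (Module.Basis (Fin r₂) Γ(S, V) Γ(M₂, V)) ∧
      Nonempty (Module.Basis (Fin r₃) Γ(S, V) Γ(M₃, V)) := by
  obtain ⟨U, hU, hx, -⟩ := exists_isAffineOpen_mem_and_subset (U := (⊤ : S.Opens)) (x := x) trivial
  obtain ⟨f, hf, v₁⟩ := h₁.exists_basis_basicOpen hU hx
  have hUf := hU.basicOpen f
  obtain ⟨g, hg, v₂⟩ := h₂.exists_basis_basicOpen hUf hf
  have hUg := hUf.basicOpen g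
  obtain ⟨a, ha, v₃⟩ := h₃.exists_basis_basicOpen hUg hg
  exact ⟨_, hUg.basicOpen a, ha, h₁.basis_basicOpen hUg a (h₁.basis_basicOpen hUf g v₁),
    h₂.basis_basicOpen hUg a v₂, v₃⟩

end Frames

/-! ### The local isometry and the local isomorphism of the reductions -/

theorem CategoryTheory.IsPullback.precomp_iso {C : Type*} [Category C] {T T' X Y Z : C} {t : T ⟶ X}
    {t' : T' ⟶ X} {a : T' ⟶ Y} {f : X ⟶ Z} {g : Y ⟶ Z} (h : IsPullback t' a f g) (e : T ≅ T')
    (he : e.hom ≫ t' = t) : IsPullback t (e.hom ≫ a) f g :=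
  IsPullback.of_iso h e.symm (Iso.refl _) (Iso.refl _) (Iso.refl _) (by simp [← he]) (by simp)
    (by simp) (by simp)

namespace LinearSection

variable {S : Scheme.{u}} {n k : ℕ} {Q : QuadricFamily S n}

open scoped TensorProduct in
/-- Nondegeneracy in a local frame: near a geometric point, each vector of a frame of the isotropic
subbundle has a dual vector up to a factor that does not vanish at the point. -/
theorem Nondegenerate.exists_dual_vector {s : LinearSection Q k} (hs : s.Nondegenerate)
    {V : S.Opens} (hV : IsAffineOpen V) (l : Module.Basis (Fin 1) Γ(S, V) Γ(Q.L, V))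
    (w : Module.Basis (Fin (k + 1)) Γ(S, V) Γ(s.W, V)) (Ω : Type u) [Field Ω] [IsAlgClosed Ω]
    [Algebra Γ(S, V) Ω] (i : Fin (k + 1)) :
    ∃ e, (∀ j ≠ i, Q.q V (l 0) e (appLin s.ι V (w j)) = 0) ∧
      algebraMap Γ(S, V) Ω (Q.q V (l 0) e (appLin s.ι V (w i))) ≠ 0 := by
  refine exists_forall_ne_eq_zero_of_span (algebraMap Γ(S, V) Ω)
    (LinearMap.pi fun j ↦ (Q.q V (l 0)).flip (appLin s.ι V (w j))) (fun v hv ↦ ?_) i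
  let v' : Ω ⊗[Γ(S, V)] Γ(s.W, V) := ∑ j, v j ⊗ₜ w j
  have hv' : v' ≠ 0 := by
    intro h0
    refine hv (funext fun j ↦ ?_)
    have h1 : v' = ∑ j, v j • w.baseChange Ω j := by
      refine Finset.sum_congr rfl fun j _ ↦ ?_
      rw [Module.Basis.baseChange_apply, TensorProduct.smul_tmul', smul_eq_mul, mul_one]
    rw [h1] at h0
    exact Fintype.linearIndependent_iff.mp (w.baseChange Ω).linearIndependent v h0 j
  obtain ⟨l', e, he⟩ := hs V hV Ω v' hv'
  refine ⟨e, fun h0 ↦ he ?_⟩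
  have hl' : l' = l.repr l' 0 • l 0 := by
    conv_lhs => rw [← l.sum_repr l']
    simp
  have h1 : ∀ w, Q.q V l' e w = l.repr l' 0 * Q.q V (l 0) e w := fun w ↦ by
    conv_lhs => rw [hl']
    simp
  calc _ = ∑ j, v j * algebraMap Γ(S, V) Ω (Q.q V l' e (appLin s.ι V (w j))) := by
        simp only [v', map_sum, LinearMap.baseChange_tmul, LinearMap.liftBaseChange_tmul,
          LinearMap.comp_apply, Algebra.linearMap_apply, smul_eq_mul]
    _ = algebraMap Γ(S, V) Ω (l.repr l' 0) *
        ∑ j, v j * algebraMap Γ(S, V) Ω (Q.q V (l 0) e (appLin s.ι V (w j))) := by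
        rw [Finset.mul_sum]
        refine Finset.sum_congr rfl fun j _ ↦ ?_
        rw [h1, map_mul]
        ring
    _ = 0 := by
        rw [← mul_zero (algebraMap Γ(S, V) Ω (l.repr l' 0))]
        exact congr_arg _ h0

theorem range_appLin_eq_span (s : LinearSection Q k) {U V : S.Opens} (h : V ≤ U) {ι : Type*}
    (w : ι → Γ(s.W, U)) (v : Module.Basis ι Γ(S, V) Γ(s.W, V)) (hv : ∀ i, v i = res s.W h (w i)) :
    LinearMap.range (appLin s.ι V) =
      Submodule.span Γ(S, V) (Set.range fun i ↦ res Q.E h (appLin s.ι U (w i))) := by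
  rw [LinearMap.range_eq_map, ← v.span_eq, Submodule.map_span, ← Set.range_comp]
  congr 2
  funext i
  rw [Function.comp_apply, hv, appLin_res]

/-- Any two nondegenerate isotropic subbundles of the same rank are locally carried to each other
by an isometry. -/
theorem exists_isometry (h2 : ∀ U : S.Opens, IsUnit (2 : Γ(S, U))) {s s' : LinearSection Q k}
    (hs : s.Nondegenerate) (hs' : s'.Nondegenerate) (x : S) :
    ∃ V : S.Opens, IsAffineOpen V ∧ x ∈ V ∧ ∃ g : Γ(Q.E, V) ≃ₗ[Γ(S, V)] Γ(Q.E, V),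
      (∀ l e e', Q.q V l (g e) (g e') = Q.q V l e e') ∧
      (LinearMap.range (appLin s.ι V)).map (g : Γ(Q.E, V) →ₗ[Γ(S, V)] Γ(Q.E, V)) =
        LinearMap.range (appLin s'.ι V) := by
  obtain ⟨U, hU, hx, ⟨l⟩, ⟨w⟩, ⟨w'⟩⟩ :=
    exists_bases Q.isVectorBundle_L s.isVectorBundle s'.isVectorBundle x
  let P := (hU.primeIdealOf ⟨x, hx⟩).asIdeal
  -- a geometric point over `x`
  let Ω := AlgebraicClosure P.ResidueField
  have hΩ : ∀ a : Γ(S, U), algebraMap Γ(S, U) Ω a ≠ 0 ↔ x ∈ S.basicOpen a := fun a ↦ by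
    rw [mem_basicOpen_iff_notMem_primeIdealOf hU hx,
      IsScalarTower.algebraMap_apply Γ(S, U) P.ResidueField Ω, Ne,
      map_eq_zero_iff _ (algebraMap P.ResidueField Ω).injective,
      Ideal.algebraMap_residueField_eq_zero]
  obtain ⟨vs, hvs, hg⟩ := exists_reflComp_eq (b := Q.q U (l 0)) (Q.symm U (l 0))
    (algebraMap Γ(S, U) Ω) ((h2 U).map (algebraMap Γ(S, U) Ω)).ne_zero
    (w := fun i ↦ appLin s.ι U (w i)) (w' := fun i ↦ appLin s'.ι U (w' i))
    (fun i j ↦ s.isotropic U _ _ _) (fun i j ↦ s'.isotropic U _ _ _)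
    (hs.exists_dual_vector hU l w Ω) (hs'.exists_dual_vector hU l w' Ω)
  set c := reflScale (Q.q U (l 0)) vs with hc
  have hle := S.basicOpen_le c
  have hR := isLocMap_resFun hU c
  obtain ⟨lV, hlV⟩ := hR.exists_basis (isLocMap_res _ Q.isVectorBundle_L hU c) l
  obtain ⟨wV, hwV⟩ := hR.exists_basis (isLocMap_res _ s.isVectorBundle hU c) w
  obtain ⟨wV', hwV'⟩ := hR.exists_basis (isLocMap_res _ s'.isVectorBundle hU c) w'
  have hb : ∀ e e', Q.q (S.basicOpen c) (lV 0) (res Q.E hle e) (res Q.E hle e') =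
      resFun hle (Q.q U (l 0) e e') := fun e e' ↦ by rw [hlV, Q.q_res]
  have hcV : reflScale (Q.q (S.basicOpen c) (lV 0)) (vs.map (res Q.E hle)) = resFun hle c :=
    reflScale_map hb vs
  obtain ⟨g, hg1, hg2⟩ := exists_isometry_of_isUnit_reflScale (b := Q.q (S.basicOpen c) (lV 0))
    (Q.symm _ (lV 0)) (vs.map (res Q.E hle)) (hcV ▸ hR.isUnit)
  refine ⟨_, hU.basicOpen c, (hΩ c).mp hvs, g, fun l' e e' ↦ ?_, ?_⟩
  · have hl' : l' = lV.repr l' 0 • lV 0 := by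
      conv_lhs => rw [← lV.sum_repr l']
      simp
    rw [hl', map_smul, LinearMap.smul_apply, LinearMap.smul_apply, LinearMap.smul_apply,
      LinearMap.smul_apply, hg1]
  · rw [s.range_appLin_eq_span hle w wV hwV, s'.range_appLin_eq_span hle w' wV' hwV',
      Submodule.map_span, ← Set.range_comp]
    congr 2
    funext i
    have h3 := hg2 (res Q.E hle (appLin s.ι U (w i)))
    rw [reflComp_map hb, hg i, hcV, LinearMap.map_smulₛₗ] at h3
    exact hR.isUnit.smul_left_cancel.mp h3

/-- Over the open sets of a suitable cover the reductions along two nondegenerate sections are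
isomorphic. The isomorphism is expressed by a common scheme `T` over `V` which is the restriction
to `V` of both reductions. -/
theorem exists_isPullback_toBase [IsLocallyNoetherian S]
    (h2 : ∀ U : S.Opens, IsUnit (2 : Γ(S, U))) {s s' : LinearSection Q k}
    (hs : s.Nondegenerate) (hs' : s'.Nondegenerate) (x : S) :
    ∃ V : S.Opens, x ∈ V ∧ ∃ (T : Scheme.{u}) (t : T ⟶ V) (a : T ⟶ s.reduction)
      (a' : T ⟶ s'.reduction), IsPullback t a V.ι s.toBase ∧ IsPullback t a' V.ι s'.toBase := by
  obtain ⟨V, hV, hx, g, hg, hW⟩ := exists_isometry h2 hs hs' x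
  let V' : S.AffineZariskiSite := ⟨V, hV⟩
  obtain ⟨e, he⟩ := HypRed.exists_proj_iso g hg hW
  have h := s.gluingData.isPullback_natTrans_ι_toBase V'
  have h' := s'.gluingData.isPullback_natTrans_ι_toBase V'
  refine ⟨V, hx, _, _, _, _, h, h'.precomp_iso e ?_⟩
  exact (Category.assoc _ _ _).symm.trans (congr_arg (· ≫ _) he)

end LinearSection

/-! ### Classes of locally isomorphic schemes -/

section Classes

variable {F : Type u} [Field F]

namespace FTScheme

theorem mk_eq_mk_of_rel {x y : FreeCommRing (FTScheme F)} (h : K0Rel (x - y)) :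
    Ideal.Quotient.mk (Ideal.span {x | K0Rel (F := F) x}) x = Ideal.Quotient.mk _ y :=
  Ideal.Quotient.eq.mpr (Ideal.subset_span h)

theorem cls_eq_of_iso {X Y : FTScheme F} (e : X.X ≅ Y.X) (h : e.hom ≫ Y.str = X.str) :
    X.cls = Y.cls :=
  mk_eq_mk_of_rel (.iso X Y e h)

/-- The fibre product `P ×_Z C` as a scheme of finite type over the field, for a scheme `P` of finite
type with a map to `Z`. It is meant for the locally closed immersions `C ⟶ Z`, where it is the
inverse image of `C` in `P`. -/
noncomputable def preimage (P : FTScheme F) {Z C : Scheme.{u}} (z : P.X ⟶ Z) (c : C ⟶ Z)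
    (h : LocallyOfFiniteType (Limits.pullback.fst z c))
    (h' : QuasiCompact (Limits.pullback.fst z c)) : FTScheme F where
  X := Limits.pullback z c
  str := Limits.pullback.fst z c ≫ P.str
  locallyOfFiniteType := by
    have := P.locallyOfFiniteType
    infer_instance
  quasiCompact := by
    have := P.quasiCompact
    infer_instance

theorem quasiCompact_pullback_fst_of_isOpenImmersion (P : FTScheme F) {Z C : Scheme.{u}}
    (z : P.X ⟶ Z) (c : C ⟶ Z) [IsOpenImmersion c] : QuasiCompact (Limits.pullback.fst z c) := by
  have := P.locallyOfFiniteType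
  have := LocallyOfFiniteType.isLocallyNoetherian P.str
  infer_instance

/-- The scissor relation for the inverse images of a closed subscheme of `Z` and of its open
complement. -/
theorem cls_eq_add (P : FTScheme F) {Z C U : Scheme.{u}} (z : P.X ⟶ Z) (c : C ⟶ Z) (j : U ⟶ Z)
    [IsClosedImmersion c] [IsOpenImmersion j] (h : IsCompl (Set.range c) (Set.range j)) :
    P.cls = (P.preimage z c inferInstance inferInstance).cls +
      (P.preimage z j inferInstance (P.quasiCompact_pullback_fst_of_isOpenImmersion z j)).cls := by
  have hc : IsClosedImmersion (Limits.pullback.fst z c) := inferInstance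
  have hj : IsOpenImmersion (Limits.pullback.fst z j) := inferInstance
  unfold cls
  rw [← map_add]
  refine mk_eq_mk_of_rel (.scissor _ _ _ (Limits.pullback.fst z c) (Limits.pullback.fst z j)
    hc hj rfl rfl ?_)
  have h1 := Scheme.Pullback.range_fst z c
  have h2 := Scheme.Pullback.range_fst z j
  have h3 : Set.range c ∩ Set.range j = ∅ := h.inf_eq_bot
  have h4 : Set.range c ∪ Set.range j = Set.univ := h.sup_eq_top
  refine IsCompl.of_eq ?_ ?_
  · change Set.range (Limits.pullback.fst z c) ∩ Set.range (Limits.pullback.fst z j) = ∅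
    rw [h1, h2, ← Set.preimage_inter, h3, Set.preimage_empty]
  · change Set.range (Limits.pullback.fst z c) ∪ Set.range (Limits.pullback.fst z j) = Set.univ
    rw [h1, h2, ← Set.preimage_union, h4, Set.preimage_univ]

variable {S X X' : Scheme.{u}} {f : X ⟶ S} {f' : X' ⟶ S} {p : S ⟶ Spec (CommRingCat.of F)}

/-- Two schemes over `S` that are isomorphic over each of finitely many open sets whose inverse
images cover `Z` have, after base change to `Z`, the same class: cut `Z` into locally closed pieces,
each lying over a member of the cover. The general `Z` is what makes the induction on the number of
open sets work; the case of interest is `Z = S`. -/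
theorem cls_eq_of_list_cover (l : List S.Opens)
    (hl : ∀ V ∈ l, ∃ (T : Scheme.{u}) (t : T ⟶ V) (a : T ⟶ X) (a' : T ⟶ X'),
      IsPullback t a V.ι f ∧ IsPullback t a' V.ι f')
    {Z : Scheme.{u}} (i : Z ⟶ S) (hZ : ∀ z, ∃ V ∈ l, i z ∈ V) {P P' : FTScheme F}
    {z : P.X ⟶ Z} {z' : P'.X ⟶ Z} {g : P.X ⟶ X} {g' : P'.X ⟶ X'}
    (hP : IsPullback z g i f) (hP' : IsPullback z' g' i f')
    (hz : z ≫ i ≫ p = P.str) (hz' : z' ≫ i ≫ p = P'.str) : P.cls = P'.cls := by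
  induction l generalizing Z P P' with
  | nil =>
    have : IsEmpty Z := ⟨fun z ↦ by simpa using hZ z⟩
    have : IsEmpty P.X := Function.isEmpty z
    have : IsEmpty P'.X := Function.isEmpty z'
    have : IsIso z := inferInstance
    have : IsIso z' := inferInstance
    exact cls_eq_of_iso (asIso z ≪≫ (asIso z').symm) (by simp [← hz, ← hz'])
  | cons V l ih =>
    -- the closed complement of the inverse image of `V`, with the reduced structure, lies over the
    -- remaining members of the cover
    let j := (i ⁻¹ᵁ V).ι
    let I := Scheme.IdealSheafData.vanishingIdeal (X := Z) ⟨(i ⁻¹ᵁ V : Set Z)ᶜ,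
      (i ⁻¹ᵁ V).2.isClosed_compl⟩
    let c := I.subschemeι
    have hc : Set.range c = (i ⁻¹ᵁ V : Set Z)ᶜ := by
      rw [Scheme.IdealSheafData.range_subschemeι, Scheme.IdealSheafData.coe_support_vanishingIdeal]
      rfl
    have hcj : IsCompl (Set.range c) (Set.range j) := by
      have hj : Set.range j = (i ⁻¹ᵁ V : Set Z) := by simp [j]
      rw [hc, hj]
      exact isCompl_compl.symm
    rw [P.cls_eq_add z c j hcj, P'.cls_eq_add z' c j hcj]
    congr 1
    · refine ih (fun V hV ↦ hl V (List.mem_cons_of_mem _ hV)) (c ≫ i) (fun y ↦ ?_)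
        ((IsPullback.of_hasPullback z c).flip.paste_vert hP)
        ((IsPullback.of_hasPullback z' c).flip.paste_vert hP') ?_ ?_
      · obtain ⟨V', hV', hy⟩ := hZ (c y)
        rcases List.mem_cons.mp hV' with rfl | h
        · exact absurd hy (hc ▸ Set.mem_range_self y : c y ∈ (i ⁻¹ᵁ V' : Set Z)ᶜ)
        · exact ⟨V', h, hy⟩
      · have : Limits.pullback.snd z c ≫ (c ≫ i) ≫ p = Limits.pullback.fst z c ≫ P.str := by
          rw [← hz, Limits.pullback.condition_assoc, Category.assoc]
        exact this
      · have : Limits.pullback.snd z' c ≫ (c ≫ i) ≫ p = Limits.pullback.fst z' c ≫ P'.str := by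
          rw [← hz', Limits.pullback.condition_assoc, Category.assoc]
        exact this
    · obtain ⟨T, t, a, a', ha, ha'⟩ := hl V List.mem_cons_self
      have hij : j ≫ i = i ∣_ V ≫ V.ι := (morphismRestrict_ι i V).symm
      have h := (IsPullback.of_hasPullback z j).flip.paste_vert hP
      have h' := (IsPullback.of_hasPullback z' j).flip.paste_vert hP'
      rw [hij] at h h'
      -- over `V ∩ Z` both inverse images are pulled back from the common scheme `T` over `V`
      have e : IsPullback _ (ha.lift (Limits.pullback.snd z j ≫ i ∣_ V)
          (Limits.pullback.fst z j ≫ g) (by rw [Category.assoc, h.w])) (i ∣_ V) t :=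
        IsPullback.of_bot (by rwa [ha.lift_snd]) (ha.lift_fst _ _ _).symm ha
      have e' : IsPullback _ (ha'.lift (Limits.pullback.snd z' j ≫ i ∣_ V)
          (Limits.pullback.fst z' j ≫ g') (by rw [Category.assoc, h'.w])) (i ∣_ V) t :=
        IsPullback.of_bot (by rwa [ha'.lift_snd]) (ha'.lift_fst _ _ _).symm ha'
      have hstr : (e.isoIsPullback _ _ e').hom ≫ Limits.pullback.fst z' j ≫ P'.str =
          Limits.pullback.fst z j ≫ P.str := by
        rw [← hz, ← hz', Limits.pullback.condition_assoc, Limits.pullback.condition_assoc,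
          e.isoIsPullback_hom_fst_assoc]
      exact cls_eq_of_iso (e.isoIsPullback _ _ e') hstr

end FTScheme

end Classes

theorem lemma2p9 {F : Type u} [Field F] (h2 : (2 : F) ≠ 0) {S : Scheme.{u}}
    (p : S ⟶ Spec (CommRingCat.of F)) [LocallyOfFiniteType p] [QuasiCompact p] {n k : ℕ}
    (Q : QuadricFamily S n) (s s' : LinearSection Q k)
    (hs : s.Nondegenerate) (hs' : s'.Nondegenerate) :
    (s.reductionOver p).cls = (s'.reductionOver p).cls := by
  have := LocallyOfFiniteType.isLocallyNoetherian p
  have h2S : ∀ U : S.Opens, IsUnit (2 : Γ(S, U)) := fun U ↦ by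
    have := ((isUnit_iff_ne_zero.mpr h2).map (Scheme.ΓSpecIso (CommRingCat.of F)).inv.hom).map
      (p.appLE ⊤ U le_top).hom
    rwa [map_ofNat, map_ofNat] at this
  have : CompactSpace S := QuasiCompact.compactSpace_of_compactSpace p
  choose V hV hT using LinearSection.exists_isPullback_toBase h2S hs hs'
  obtain ⟨t, ht⟩ := CompactSpace.elim_nhds_subcover (fun x ↦ (V x : Set S))
    fun x ↦ (V x).2.mem_nhds (hV x)
  refine FTScheme.cls_eq_of_list_cover (p := p) (f := s.toBase) (f' := s'.toBase)
    (t.toList.map V) ?_ (𝟙 S) (fun z ↦ ?_) 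
    (IsPullback.of_vert_isIso ⟨by simp⟩ : IsPullback s.toBase (𝟙 _) (𝟙 S) s.toBase)
    (IsPullback.of_vert_isIso ⟨by simp⟩ : IsPullback s'.toBase (𝟙 _) (𝟙 S) s'.toBase) ?_ ?_
  · simp only [List.mem_map, Finset.mem_toList, forall_exists_index, and_imp]
    rintro _ x - rfl
    exact hT x
  · have : z ∈ ⋃ x ∈ t, (V x : Set S) := ht ▸ Set.mem_univ z
    simpa using this
  · simp [LinearSection.reductionOver]
  · simp [LinearSection.reductionOver]
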